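/- Let $\tau\in\mathbb R$ and $0<H<\tfrac12$. Let $\Omega=\{(x,y)\in\mathbb R^2: x^2+y^2<1\}$, let $\partial_\infty\Omega$ be the unit circle, and put $\lambda=\frac{2}{1-x^2-y^2}$, $$a=2\tau y+2Hx\sqrt{\tfrac{1+4\tau^2(x^2+y^2)}{1-4H^2(x^2+y^2)}},\qquad b=-2\tau x+2Hy\sqrt{\tfrac{1+4\tau^2(x^2+y^2)}{1-4H^2(x^2+y^2)}} .$$ Consider the $H$-cylinder model of $\mathbb E(-1,\tau)$, that is, $\Omega\times\mathbb R$ with the Riemannian metric $\lambda^2(dx^2+dy^2)+[\lambda(a\,dx+b\,dy)+dt]^2$. For $u\in C^\infty(\Omega)$, the mean curvature of the graph of $u$ with respect to its upward unit normal is $$\tfrac12\operatorname{div}\Big(\frac{Gu}{\sqrt{1+\|Gu\|^2}}\Big),\qquad Gu=\lambda^{-2}\big[(u_x+\lambda a)\partial_x+(u_y+\lambda b)\partial_y\big],$$ where $\operatorname{div}$ and $\|\cdot\|$ refer to the hyperbolic metric $\lambda^2(dx^2+dy^2)$. The graph is an entire $H$-graph if this equals $H$ on all of $\Omega$ (for example,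 the slices $\{t=\text{const}\}$ are entire $H$-graphs). The function $u$ has asymptotic boundary function $f\colon\partial_\infty\Omega\to\mathbb R$ if $u(p_n)\to f(p)$ whenever $p_n\in\Omega$ converges to $p\in\partial_\infty\Omega$. A rotation about the vertical axis over $p\in\Omega$ is an element of the circle group of isometries of this space that fix every point of $\{p\}\times\mathbb R$. **Proposition.** Let $g\in C^\infty(\partial_\infty\Omega)$ and $q\in\partial_\infty\Omega$. There is $c_0>0$ such that for every $c\ge c_0$ there is an entire $H$-graph, the graph of some $\omega^q_c\in C^\infty(\Omega)$, that is invariant under all rotations about the vertical axis over some point at hyperbolic distance $c$ from the origin of $\Omega$, and that has an asymptotic boundary function $f^q_c\in C^\infty(\partial_\infty\Omega)$ with $$f^q_c(q)=g(q)\qquad\text{and}\qquad f^q_c>g\ \text{ on }\ \partial_\infty\Omega\setminus\{q\}.$$ If moreover $q$ is a critical point of $g$, then $\omega^q_c$ can be chosen so that, in addition, $f^q_c$ attains its minimum at $q$. -/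

import Mathlib

open scoped ContDiff Manifold

noncomputable section

namespace HCylinder

/-- The open unit disk `Ω ⊆ ℝ² = ℂ`, the base of the model; a point is `z = x + i y`. -/
def disk : Set ℂ := Metric.ball 0 1

/-- The total space `Ω × ℝ` of the model. -/
def cylinder : Set (ℂ × ℝ) := {p | p.1 ∈ disk}

/-- The conformal factor `λ = 2 / (1 - x² - y²)` of the Poincaré disk. -/
def conf (z : ℂ) : ℝ := 2 / (1 - (z.re ^ 2 + z.im ^ 2))

/-- The radial factor `√((1 + 4 τ² r²) / (1 - 4 H² r²))`, where `r² = x² + y²`. -/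
def radialFactor (τ H : ℝ) (z : ℂ) : ℝ :=
  √((1 + 4 * (z.re ^ 2 + z.im ^ 2) * τ ^ 2) / (1 - 4 * H ^ 2 * (z.re ^ 2 + z.im ^ 2)))

/-- The coefficient `a` of `dx` in the connection form of the `H`-cylinder model. -/
def coeffA (τ H : ℝ) (z : ℂ) : ℝ := 2 * z.im * τ + 2 * H * z.re * radialFactor τ H z

/-- The coefficient `b` of `dy` in the connection form of the `H`-cylinder model. -/
def coeffB (τ H : ℝ) (z : ℂ) : ℝ := -2 * z.re * τ + 2 * H * z.im * radialFactor τ H z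

/-- The one-form `λ (a dx + b dy) + dt`, evaluated at a tangent vector `v` over the point `z`. -/
def connForm (τ H : ℝ) (z : ℂ) (v : ℂ × ℝ) : ℝ :=
  conf z * (coeffA τ H z * v.1.re + coeffB τ H z * v.1.im) + v.2

/-- The Riemannian metric `λ² (dx² + dy²) + [λ (a dx + b dy) + dt]²` of the `H`-cylinder model of
`𝔼(-1, τ)`, as a bilinear form on the tangent space at the point `p` of `Ω × ℝ`. -/
def metric (τ H : ℝ) (p v w : ℂ × ℝ) : ℝ :=
  conf p.1 ^ 2 * (v.1.re * w.1.re + v.1.im * w.1.im) + connForm τ H p.1 v * connForm τ H p.1 w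

/-- `Φ` is (on `Ω × ℝ`) a smooth isometry of the `H`-cylinder model onto itself. -/
structure IsIsom (τ H : ℝ) (Φ : ℂ × ℝ → ℂ × ℝ) : Prop where
  bijOn : Set.BijOn Φ cylinder cylinder
  smooth : ContDiffOn ℝ ∞ Φ cylinder
  preserves : ∀ p ∈ cylinder, ∀ v w : ℂ × ℝ,
    metric τ H (Φ p) (fderiv ℝ Φ p v) (fderiv ℝ Φ p w) = metric τ H p v w

/-- `R` is the circle group of rotations about the vertical axis over `a`: a continuous, faithful
action of the circle on `Ω × ℝ` by isometries that fix every point of the fibre over `a`. -/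
structure IsRotationGroup (τ H : ℝ) (a : ℂ) (R : Circle → ℂ × ℝ → ℂ × ℝ) : Prop where
  isom : ∀ θ, IsIsom τ H (R θ)
  map_one : ∀ p ∈ cylinder, R 1 p = p
  map_mul : ∀ θ θ', ∀ p ∈ cylinder, R (θ * θ') p = R θ (R θ' p)
  continuousOn : ContinuousOn (fun x : Circle × (ℂ × ℝ) => R x.1 x.2) (Set.univ ×ˢ cylinder)
  fixes_axis : ∀ θ (t : ℝ), R θ (a, t) = (a, t)
  faithful : ∀ θ, (∀ p ∈ cylinder, R θ p = p) → θ = 1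

/-- The surface `S` is invariant under the rotations about the vertical axis over `a ∈ Ω`. -/
def IsRotationallyInvariant (τ H : ℝ) (a : ℂ) (S : Set (ℂ × ℝ)) : Prop :=
  a ∈ disk ∧ ∃ R, IsRotationGroup τ H a R ∧ ∀ θ, R θ '' S = S

/-- The entire vertical graph `{(z, u z) | z ∈ Ω}`. -/
def graph (u : ℂ → ℝ) : Set (ℂ × ℝ) := {p | p.1 ∈ disk ∧ p.2 = u p.1}

/-- The generalized gradient `Gu = λ⁻² [(u_x + λ a) ∂_x + (u_y + λ b) ∂_y]`, a vector field on `Ω`.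
The upward unit normal of the graph of `u` is `(∂_t - Gu) / √(1 + ‖Gu‖²)`, with `Gu` lifted
horizontally with respect to `connForm`. -/
def genGrad (τ H : ℝ) (u : ℂ → ℝ) (z : ℂ) : ℂ :=
  ⟨(fderiv ℝ u z 1 + conf z * coeffA τ H z) / conf z ^ 2,
   (fderiv ℝ u z Complex.I + conf z * coeffB τ H z) / conf z ^ 2⟩

/-- The divergence `λ⁻² [∂_x (λ² X₁) + ∂_y (λ² X₂)]` of a vector field for the hyperbolic metric
`λ² (dx² + dy²)`. -/
def hypDiv (X : ℂ → ℂ) (z : ℂ) : ℝ :=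
  (fderiv ℝ (fun w => conf w ^ 2 * (X w).re) z 1 +
    fderiv ℝ (fun w => conf w ^ 2 * (X w).im) z Complex.I) / conf z ^ 2

/-- The mean curvature `½ div (Gu / √(1 + ‖Gu‖²))` of the graph of `u` with respect to its upward
unit normal; `‖·‖` is the hyperbolic norm, which is `λ` times the Euclidean one. -/
def meanCurvature (τ H : ℝ) (u : ℂ → ℝ) (z : ℂ) : ℝ :=
  hypDiv (fun w => ((√(1 + (conf w * ‖genGrad τ H u w‖) ^ 2))⁻¹ : ℝ) • genGrad τ H u w) z / 2

/-- `u` is a smooth function on `Ω` whose graph has constant mean curvature `H`. -/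
def IsEntireHGraph (τ H : ℝ) (u : ℂ → ℝ) : Prop :=
  ContDiffOn ℝ ∞ u disk ∧ ∀ z ∈ disk, meanCurvature τ H u z = H

/-- `u` has asymptotic boundary value `f` on `∂_∞Ω`, the unit circle: `u (pₙ) → f p` whenever the
points `pₙ ∈ Ω` converge to `p ∈ ∂_∞Ω`. -/
def HasAsymptoticBoundaryValue (u : ℂ → ℝ) (f : Circle → ℝ) : Prop :=
  ∀ p : Circle, Filter.Tendsto u (nhdsWithin (p : ℂ) disk) (nhds (f p))

end HCylinder

end

/-!
The slice `t = 0` is an entire `H`-graph that is invariant under the rotations over the origin. Its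
image under an isometry of the model that moves the origin to a point `a` is the graph of an
explicit function, `tiltedSlice`. If `M = mob a` is the hyperbolic isometry taking `a` to `0`, and
`θ = λ (a dx + b dy)` is the horizontal part of the connection form, then
`d (tiltedSlice) = M^* θ - θ` (`hasFDerivAt_tiltedSlice`). This single identity shows that
`(z, t) ↦ (M z, t - tiltedSlice z)` is an isometry onto the model (`isIsom_straighten`), by which
the rotations over `a` are conjugated to the Euclidean rotations over `0`, and that the generalized
gradient is the pullback of that of a slice, so that the mean curvature is again `H`
(`isEntireHGraph_tiltedSlice`).

The formula for `tiltedSlice` is smooth up to the boundary circle, where, at the point `q e^{is}`,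
it equals `profile`: the real part of `2 K (1 - i β) log (1 - b e^{is})`, plus a constant, with
`b = ā q` and `K, β` depending only on `τ, H`. In terms of `ζ = b / (1 - b)`, the difference of the
values at `s` and `0` is the real part of `2 K (1 - i β) log (1 + (1 - e^{is}) ζ)`, and its slope at
`s = 0` is a prescribed `m` exactly when `ζ` lies on a line `slopeLine`. Moving `ζ` to infinity on
the line for `m = g'(q)` moves `|b| = |a|` to `1`, and every modulus close to `1` is attained
(`exists_norm_slopeLine_div_eq`). Near `s = 0` the derivative of the profile beats that of `g`, by a
term that is quadratic in `|ζ|`; away from `s = 0` the profile is as large as one wishes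
(`exists_forall_lt_profile_sub`). The bound depends only on `m` and on bounds for `g`; if `m = 0`, it
applies to constant functions too, so that the boundary function has its minimum at `q`.
-/

noncomputable section

namespace HCylinder

open Complex Set ComplexConjugate

/-! ### The height of the rotational `H`-graph -/

/-- The radial factor as a function of `t = |z|²`. -/
def radialWeight (τ H t : ℝ) : ℝ := √((1 + 4 * t * τ ^ 2) / (1 - 4 * H ^ 2 * t))

/-- The number `K = 2 H √((1 + 4 τ²) / (1 - 4 H²))`: in the standard model, the rotational `H`-graph
grows like `-K log (1 - |z|²)` at the boundary circle. -/
def growthRate (τ H : ℝ) : ℝ := 2 * H * radialWeight τ H 1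

/-- The open interval of those `t` at which both the numerator and the denominator of
`radialWeight` are positive. It contains `[0, 1]`. -/
def radialDomain (τ H : ℝ) : Set ℝ := {t | 0 < 1 + 4 * t * τ ^ 2 ∧ 0 < 1 - 4 * H ^ 2 * t}

/-- The quotient `(2 H radialWeight t - K) / (1 - t)`, written without division by `1 - t`, so
that it is visibly smooth at `t = 1`. -/
def regDensity (τ H t : ℝ) : ℝ :=
  -8 * H * (H ^ 2 + τ ^ 2) /
    ((1 - 4 * H ^ 2 * t) * (1 - 4 * H ^ 2) * (radialWeight τ H t + radialWeight τ H 1))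

/-- The regular part of the height of the rotational `H`-graph, as a function of `s = |z|²`: the
height itself is `-K log (1 - s) + regHeight s`. -/
def regHeight (τ H s : ℝ) : ℝ := ∫ t in (0 : ℝ)..s, regDensity τ H t

variable {τ H : ℝ}

lemma radialFactor_eq (z : ℂ) : radialFactor τ H z = radialWeight τ H (normSq z) := by
  simp only [radialFactor, radialWeight, normSq_apply, ← pow_two]

lemma isOpen_radialDomain : IsOpen (radialDomain τ H) :=
  IsOpen.and (isOpen_lt continuous_const (by fun_prop)) (isOpen_lt continuous_const (by fun_prop))

lemma convex_radialDomain : Convex ℝ (radialDomain τ H) := by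
  rintro x ⟨hx1, hx2⟩ y ⟨hy1, hy2⟩ s t hs ht hst
  simp only [radialDomain, mem_ofPred_eq, smul_eq_mul]
  have hs' : s = 1 - t := by linarith
  subst hs'
  have h : 0 < 1 - t ∨ 0 < t := by
    by_contra! h
    linarith
  constructor <;> rcases h with h | h <;> nlinarith [mul_pos h hx1, mul_pos h hx2, mul_pos h hy1,
    mul_pos h hy2, mul_nonneg ht hy1.le, mul_nonneg ht hy2.le, mul_nonneg hs hx1.le,
    mul_nonneg hs hx2.le]

lemma mem_radialDomain (hH₀ : 0 < H) (hH₁ : H < 1 / 2) {t : ℝ} (h0 : 0 ≤ t) (h1 : t ≤ 1) :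
    t ∈ radialDomain τ H := by
  refine ⟨by positivity, ?_⟩
  have : H ^ 2 < 1 / 4 := by nlinarith
  nlinarith [sq_nonneg H]

lemma radialWeight_pos {t : ℝ} (ht : t ∈ radialDomain τ H) : 0 < radialWeight τ H t :=
  Real.sqrt_pos.2 (div_pos ht.1 ht.2)

lemma sq_radialWeight {t : ℝ} (ht : t ∈ radialDomain τ H) :
    radialWeight τ H t ^ 2 = (1 + 4 * t * τ ^ 2) / (1 - 4 * H ^ 2 * t) :=
  Real.sq_sqrt (div_pos ht.1 ht.2).le

lemma growthRate_pos (hH₀ : 0 < H) (hH₁ : H < 1 / 2) : 0 < growthRate τ H :=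
  mul_pos (by positivity) (radialWeight_pos (mem_radialDomain hH₀ hH₁ zero_le_one le_rfl))

lemma contDiffOn_radialWeight : ContDiffOn ℝ ∞ (radialWeight τ H) (radialDomain τ H) := by
  unfold radialWeight
  refine ContDiffOn.sqrt (ContDiffOn.div (by fun_prop) (by fun_prop) fun t ht => ht.2.ne')
    fun t ht => (div_pos ht.1 ht.2).ne'

lemma one_sub_mul_regDensity (hH₀ : 0 < H) (hH₁ : H < 1 / 2) {t : ℝ} (ht : t ∈ radialDomain τ H) :
    (1 - t) * regDensity τ H t = 2 * H * radialWeight τ H t - growthRate τ H := by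
  have h1 : (1 : ℝ) ∈ radialDomain τ H := mem_radialDomain hH₀ hH₁ zero_le_one le_rfl
  have p := radialWeight_pos ht
  have p1 := radialWeight_pos h1
  have e := sq_radialWeight ht
  have e1 := sq_radialWeight h1
  have d := ht.2
  have d1 := h1.2
  rw [mul_one] at d1
  rw [mul_one, mul_one] at e1
  rw [eq_div_iff d.ne'] at e
  rw [eq_div_iff d1.ne'] at e1
  rw [regDensity, growthRate, mul_div_assoc', div_eq_iff (by positivity)]
  linear_combination (-2 * H) * (1 - 4 * H ^ 2) * e + 2 * H * (1 - 4 * H ^ 2 * t) * e1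

lemma contDiffOn_regDensity (hH₀ : 0 < H) (hH₁ : H < 1 / 2) :
    ContDiffOn ℝ ∞ (regDensity τ H) (radialDomain τ H) := by
  have h1 : (1 : ℝ) ∈ radialDomain τ H := mem_radialDomain hH₀ hH₁ zero_le_one le_rfl
  refine ContDiffOn.div (by fun_prop) ?_ fun t ht => ?_
  · exact ContDiffOn.mul (by fun_prop) (contDiffOn_radialWeight.add contDiffOn_const)
  · have d1 := h1.2
    rw [mul_one] at d1
    have := radialWeight_pos ht
    have := radialWeight_pos h1
    have := ht.2
    positivity

lemma hasDerivAt_regHeight (hH₀ : 0 < H) (hH₁ : H < 1 / 2) {s : ℝ} (hs : s ∈ radialDomain τ H) :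
    HasDerivAt (regHeight τ H) (regDensity τ H s) s := by
  have hc := (contDiffOn_regDensity (τ := τ) hH₀ hH₁).continuousOn
  have h0 : (0 : ℝ) ∈ radialDomain τ H := mem_radialDomain hH₀ hH₁ le_rfl zero_le_one
  refine intervalIntegral.integral_hasDerivAt_right ?_ ?_
    (hc.continuousAt (isOpen_radialDomain.mem_nhds hs))
  · exact (hc.mono (convex_radialDomain.ordConnected.uIcc_subset h0 hs)).intervalIntegrable
  · exact hc.stronglyMeasurableAtFilter isOpen_radialDomain s hs

lemma contDiffOn_regHeight (hH₀ : 0 < H) (hH₁ : H < 1 / 2) :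
    ContDiffOn ℝ ∞ (regHeight τ H) (radialDomain τ H) := by
  rw [contDiffOn_infty_iff_deriv_of_isOpen isOpen_radialDomain]
  exact ⟨fun s hs => (hasDerivAt_regHeight hH₀ hH₁ hs).differentiableAt.differentiableWithinAt,
    (contDiffOn_regDensity hH₀ hH₁).congr fun s hs => (hasDerivAt_regHeight hH₀ hH₁ hs).deriv⟩

/-! ### Möbius transformations of the disk -/

/-- The Möbius transformation `z ↦ (z - a) / (1 - ā z)`, which for `‖a‖ < 1` is an isometry of the
hyperbolic disk taking `a` to the origin. -/
def mob (a z : ℂ) : ℂ := (z - a) / (1 - conj a * z)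

/-- The complex derivative of `mob a`. -/
def mobDeriv (a z : ℂ) : ℂ := (1 - normSq a) / (1 - conj a * z) ^ 2

lemma mem_disk {z : ℂ} : z ∈ disk ↔ ‖z‖ < 1 := by simp [disk]

lemma isOpen_disk : IsOpen disk := Metric.isOpen_ball

lemma normSq_lt_one {z : ℂ} (hz : z ∈ disk) : normSq z < 1 := by
  rw [mem_disk] at hz
  rw [normSq_eq_norm_sq]
  nlinarith [norm_nonneg z]

lemma mem_disk_of_normSq {z : ℂ} (hz : normSq z < 1) : z ∈ disk := by
  rw [normSq_eq_norm_sq] at hz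
  rw [mem_disk]
  nlinarith [norm_nonneg z]

lemma norm_conj_mul_lt {a z : ℂ} (ha : ‖a‖ < 1) (hz : ‖z‖ ≤ 1) : ‖conj a * z‖ < 1 := by
  rw [norm_mul, norm_conj]
  nlinarith [norm_nonneg a, norm_nonneg z]

lemma one_sub_mem_slitPlane {w : ℂ} (hw : ‖w‖ < 1) : 1 - w ∈ slitPlane :=
  Or.inl (by simpa using (re_le_norm w).trans_lt hw)

lemma one_sub_conj_mul_ne_zero {a z : ℂ} (ha : ‖a‖ < 1) (hz : ‖z‖ ≤ 1) : 1 - conj a * z ≠ 0 :=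
  slitPlane_ne_zero (one_sub_mem_slitPlane (norm_conj_mul_lt ha hz))

lemma one_sub_normSq_mob {a z : ℂ} (ha : ‖a‖ < 1) (hz : ‖z‖ ≤ 1) :
    1 - normSq (mob a z) = (1 - normSq a) * (1 - normSq z) / normSq (1 - conj a * z) := by
  have h0 := one_sub_conj_mul_ne_zero ha hz
  have h : normSq (1 - conj a * z) ≠ 0 := by simpa using h0
  rw [mob, map_div₀, eq_div_iff h, sub_mul, div_mul_cancel₀ _ h]
  simp only [normSq_apply, sub_re, sub_im, mul_re, mul_im, one_re, one_im, conj_re, conj_im]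
  ring

lemma normSq_mob_le_one {a z : ℂ} (ha : ‖a‖ < 1) (hz : ‖z‖ ≤ 1) : normSq (mob a z) ≤ 1 := by
  have h := one_sub_normSq_mob ha hz
  have h1 : normSq a ≤ 1 := by rw [normSq_eq_norm_sq]; nlinarith [norm_nonneg a]
  have h2 : normSq z ≤ 1 := by rw [normSq_eq_norm_sq]; nlinarith [norm_nonneg z]
  have : 0 ≤ 1 - normSq (mob a z) := by
    rw [h]
    exact div_nonneg (mul_nonneg (by linarith) (by linarith)) (normSq_nonneg _)
  linarith

lemma mob_mem_disk {a z : ℂ} (ha : a ∈ disk) (hz : z ∈ disk) : mob a z ∈ disk := by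
  have ha' := mem_disk.1 ha
  have hz' := mem_disk.1 hz
  apply mem_disk_of_normSq
  have h := one_sub_normSq_mob ha' hz'.le
  have : 0 < 1 - normSq (mob a z) := by
    rw [h]
    exact div_pos (mul_pos (by linarith [normSq_lt_one ha]) (by linarith [normSq_lt_one hz]))
      (normSq_pos.2 (one_sub_conj_mul_ne_zero ha' hz'.le))
  linarith

lemma neg_mem_disk {a : ℂ} (ha : a ∈ disk) : -a ∈ disk := by
  rw [mem_disk] at *
  simpa using ha

lemma mob_neg_mob {a z : ℂ} (ha : a ∈ disk) (hz : z ∈ disk) : mob (-a) (mob a z) = z := by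
  have h1 := one_sub_conj_mul_ne_zero (mem_disk.1 ha) (mem_disk.1 hz).le
  have h2 := one_sub_conj_mul_ne_zero (mem_disk.1 (neg_mem_disk ha))
    (mem_disk.1 (mob_mem_disk ha hz)).le
  rw [mob, div_eq_iff h2, mob, map_neg]
  generalize conj a = b at h1
  have e : (z - a) / (1 - b * z) * (1 - b * z) = z - a := div_mul_cancel₀ _ h1
  linear_combination e

lemma hasDerivAt_mob {a z : ℂ} (ha : ‖a‖ < 1) (hz : ‖z‖ ≤ 1) :
    HasDerivAt (mob a) (mobDeriv a z) z := by
  have h0 := one_sub_conj_mul_ne_zero ha hz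
  have h1 : HasDerivAt (fun w : ℂ => w - a) 1 z := (hasDerivAt_id z).sub_const a
  have h2 : HasDerivAt (fun w : ℂ => 1 - conj a * w) (-(conj a * 1)) z :=
    ((hasDerivAt_id z).const_mul (conj a)).const_sub 1
  refine (h1.div h2 h0).congr_deriv ?_
  rw [mobDeriv, ← mul_conj]
  congr 1
  ring

lemma contDiffAt_mob {a z : ℂ} (ha : ‖a‖ < 1) (hz : ‖z‖ ≤ 1) : ContDiffAt ℝ ∞ (mob a) z := by
  have h : ContDiffAt ℂ ∞ (mob a) z := by
    unfold mob
    exact ContDiffAt.div (by fun_prop) (by fun_prop) (one_sub_conj_mul_ne_zero ha hz)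
  exact h.restrict_scalars ℝ

lemma conf_eq (z : ℂ) : conf z = 2 / (1 - normSq z) := by
  simp only [conf, normSq_apply, ← pow_two]

lemma conf_pos {z : ℂ} (hz : z ∈ disk) : 0 < conf z := by
  rw [conf_eq]
  exact div_pos two_pos (by linarith [normSq_lt_one hz])

lemma conf_mob {a z : ℂ} (ha : a ∈ disk) (hz : z ∈ disk) :
    conf (mob a z) * (1 - normSq a) = conf z * normSq (1 - conj a * z) := by
  have ha' := mem_disk.1 ha
  have hz' := mem_disk.1 hz
  have h0 : normSq (1 - conj a * z) ≠ 0 := by simpa using one_sub_conj_mul_ne_zero ha' hz'.le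
  have h1 : 1 - normSq a ≠ 0 := by linarith [normSq_lt_one ha]
  have h2 : 1 - normSq z ≠ 0 := by linarith [normSq_lt_one hz]
  rw [conf_eq, conf_eq, one_sub_normSq_mob ha' hz'.le]
  field_simp

lemma conf_mob_sq_mul_normSq_mobDeriv {a z : ℂ} (ha : a ∈ disk) (hz : z ∈ disk) :
    conf (mob a z) ^ 2 * normSq (mobDeriv a z) = conf z ^ 2 := by
  have h := conf_mob ha hz
  have h0 : normSq (1 - conj a * z) ≠ 0 := by
    simpa using one_sub_conj_mul_ne_zero (mem_disk.1 ha) (mem_disk.1 hz).le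
  rw [mobDeriv, map_div₀, map_pow, ← ofReal_one, ← ofReal_sub, normSq_ofReal, ofReal_one,
    mul_div_assoc', div_eq_iff (pow_ne_zero 2 h0)]
  linear_combination (conf (mob a z) * (1 - normSq a) + conf z * normSq (1 - conj a * z)) * h

/-- The vector field `λ(z) z` is almost invariant under Möbius transformations: its pullback
differs from it by the gradient of `2 log |1 - ā z|`. -/
lemma conf_mob_mul_mob {a z : ℂ} (ha : a ∈ disk) (hz : z ∈ disk) :
    conf (mob a z) * mob a z * conj (mobDeriv a z) =
      conf z * z - 2 * a / (1 - a * conj z) := by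
  have h0 := one_sub_conj_mul_ne_zero (mem_disk.1 ha) (mem_disk.1 hz).le
  have h0' : 1 - a * conj z ≠ 0 := by
    intro h
    apply h0
    simpa using congrArg conj h
  have h := congrArg ((↑) : ℝ → ℂ) (conf_mob ha hz)
  have hz2 : 1 - normSq z ≠ 0 := by linarith [normSq_lt_one hz]
  have hc : (conf z : ℂ) * (1 - normSq z) = 2 := by
    rw [conf_eq]
    push_cast
    rw [div_mul_cancel₀]
    exact_mod_cast hz2
  push_cast at h
  rw [← mul_conj (1 - conj a * z)] at h
  simp only [map_sub, map_mul, map_one, conj_conj] at h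
  have e : conj (mobDeriv a z) = (1 - normSq a) / (1 - a * conj z) ^ 2 := by
    simp [mobDeriv]
  rw [e, mob]
  rw [mob] at h
  have key : (conf z * (z - a)) / (1 - a * conj z) = conf z * z - 2 * a / (1 - a * conj z) := by
    rw [← hc, ← mul_conj z]
    field_simp
    ring
  rw [← key]
  generalize (conf ((z - a) / (1 - conj a * z)) : ℂ) = C at h
  generalize conj a = b at h h0
  have e' : (z - a) / (1 - b * z) * (1 - b * z) = z - a := div_mul_cancel₀ _ h0
  rw [mul_div_assoc', div_eq_div_iff (pow_ne_zero 2 h0') h0']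
  linear_combination (z - a) / (1 - b * z) * (1 - a * conj z) * h +
    conf z * (1 - a * conj z) ^ 2 * e'

/-! ### The graph and its gradient -/

/-- The covector `λ (a dx + b dy)` of the model, as a complex number: its real part is the
coefficient of `dx` and its imaginary part that of `dy`. -/
def connVec (τ H : ℝ) (z : ℂ) : ℂ :=
  conf z * z * (2 * H * radialWeight τ H (normSq z) - 2 * τ * I)

lemma re_connVec (z : ℂ) : (connVec τ H z).re = conf z * coeffA τ H z := by
  rw [connVec, coeffA, radialFactor_eq]
  simp
  ring

lemma im_connVec (z : ℂ) : (connVec τ H z).im = conf z * coeffB τ H z := by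
  rw [connVec, coeffB, radialFactor_eq]
  simp
  ring

/-- The image of a slice of the model under an isometry that moves the origin to `a`, as the graph
of a function. The term with the logarithm collects the singular part of the height of a rotational
`H`-graph and the potential of the difference between the connection form and its pullback. The
formula makes sense, and is smooth, on a neighbourhood of the closed disk. -/
def tiltedSlice (τ H : ℝ) (a : ℂ) (t : ℝ) (z : ℂ) : ℝ :=
  ((2 * growthRate τ H + 4 * τ * I) * log (1 - conj a * z)).re +
    (regHeight τ H (normSq (mob a z)) - regHeight τ H (normSq z)) + t

lemma contDiffAt_normSq (z : ℂ) : ContDiffAt ℝ ∞ normSq z := by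
  have : (normSq : ℂ → ℝ) = fun z => reCLM z * reCLM z + imCLM z * imCLM z := by
    ext z; simp [normSq_apply]
  rw [this]
  fun_prop

lemma contDiffAt_tiltedSlice (hH₀ : 0 < H) (hH₁ : H < 1 / 2) {a : ℂ} (ha : ‖a‖ < 1) (t : ℝ) {z : ℂ}
    (hz : ‖z‖ ≤ 1) : ContDiffAt ℝ ∞ (tiltedSlice τ H a t) z := by
  have hS : ∀ s, 0 ≤ s → s ≤ 1 → ContDiffAt ℝ ∞ (regHeight τ H) s := fun s h0 h1 =>
    (contDiffOn_regHeight hH₀ hH₁).contDiffAt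
      (isOpen_radialDomain.mem_nhds (mem_radialDomain hH₀ hH₁ h0 h1))
  have hz2 : normSq z ≤ 1 := by rw [normSq_eq_norm_sq]; nlinarith [norm_nonneg z]
  have hlog : ContDiffAt ℝ ∞
      (fun z => (2 * growthRate τ H + 4 * τ * I) * log (1 - conj a * z)) z := by
    have : ContDiffAt ℂ ∞ (fun z => (2 * growthRate τ H + 4 * τ * I) * log (1 - conj a * z)) z :=
      contDiffAt_const.mul ((contDiffAt_log (one_sub_mem_slitPlane (norm_conj_mul_lt ha hz))).comp z
        (f := fun z => 1 - conj a * z) (by fun_prop))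
    exact this.restrict_scalars ℝ
  have h1 : ContDiffAt ℝ ∞ (fun z => regHeight τ H (normSq (mob a z))) z :=
    (hS _ (normSq_nonneg _) (normSq_mob_le_one ha hz)).comp z
      (f := fun z => normSq (mob a z)) ((contDiffAt_normSq _).comp z (contDiffAt_mob ha hz))
  have h2 : ContDiffAt ℝ ∞ (fun z => regHeight τ H (normSq z)) z :=
    (hS _ (normSq_nonneg _) hz2).comp z (contDiffAt_normSq _)
  exact ((reCLM.contDiff.contDiffAt.comp z hlog).add (h1.sub h2)).add contDiffAt_const

lemma hasFDerivAt_re {f : ℂ → ℂ} {f' z : ℂ} (h : HasDerivAt f f' z) :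
    HasFDerivAt (fun w => (f w).re) (innerSL ℝ (conj f')) z := by
  refine (reCLM.hasFDerivAt.comp z h.complexToReal_fderiv).congr_fderiv ?_
  ext
  simp [Complex.inner]
  ring

lemma hasFDerivAt_normSq {f : ℂ → ℂ} {f' z : ℂ} (h : HasDerivAt f f' z) :
    HasFDerivAt (fun w => normSq (f w)) (innerSL ℝ (2 * f z * conj f')) z := by
  have h' := h.complexToReal_fderiv
  have e : (fun w => normSq (f w)) = fun w => reCLM (f w) * reCLM (f w) +
      imCLM (f w) * imCLM (f w) := by
    ext w; simp [normSq_apply]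
  have hr := reCLM.hasFDerivAt.comp z h'
  have hi := imCLM.hasFDerivAt.comp z h'
  rw [e]
  refine ((hr.mul hr).add (hi.mul hi)).congr_fderiv ?_
  ext
  simp [Complex.inner]
  ring

lemma hasFDerivAt_regHeight (hH₀ : 0 < H) (hH₁ : H < 1 / 2) {f : ℂ → ℂ} {f' z : ℂ}
    (h : HasDerivAt f f' z) (hz : normSq (f z) ≤ 1) :
    HasFDerivAt (fun w => regHeight τ H (normSq (f w)))
      (innerSL ℝ (regDensity τ H (normSq (f z)) * (2 * f z * conj f'))) z := by
  have hS := hasDerivAt_regHeight hH₀ hH₁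
    (mem_radialDomain (τ := τ) hH₀ hH₁ (normSq_nonneg (f z)) hz)
  refine (hS.comp_hasFDerivAt z (hasFDerivAt_normSq h)).congr_fderiv ?_
  rw [← real_smul, map_smul]

lemma two_mul_regDensity (hH₀ : 0 < H) (hH₁ : H < 1 / 2) {z : ℂ} (hz : z ∈ disk) :
    2 * regDensity τ H (normSq z) =
      conf z * (2 * H * radialWeight τ H (normSq z) - growthRate τ H) := by
  have h := one_sub_mul_regDensity hH₀ hH₁
    (mem_radialDomain (τ := τ) hH₀ hH₁ (normSq_nonneg z) (normSq_lt_one hz).le)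
  have h2 : 1 - normSq z ≠ 0 := by linarith [normSq_lt_one hz]
  rw [← h, conf_eq]
  field_simp

/-- The differential of `tiltedSlice` is the difference between the pullback of the connection form
under `mob a` and the connection form itself. -/
lemma hasFDerivAt_tiltedSlice (hH₀ : 0 < H) (hH₁ : H < 1 / 2) {a : ℂ} (ha : a ∈ disk) (t : ℝ)
    {z : ℂ} (hz : z ∈ disk) :
    HasFDerivAt (tiltedSlice τ H a t)
      (innerSL ℝ (conj (mobDeriv a z) * connVec τ H (mob a z) - connVec τ H z)) z := by
  have ha' := mem_disk.1 ha
  have hz' := mem_disk.1 hz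
  have h0 := one_sub_conj_mul_ne_zero ha' hz'.le
  have h0' : 1 - a * conj z ≠ 0 := by
    intro h
    apply h0
    simpa using congrArg conj h
  have hlin : HasDerivAt (fun w : ℂ => 1 - conj a * w) (-(conj a * 1)) z :=
    ((hasDerivAt_id z).const_mul (conj a)).const_sub 1
  have h1 := hasFDerivAt_re ((hlin.clog (one_sub_mem_slitPlane
    (norm_conj_mul_lt ha' hz'.le))).const_mul (2 * growthRate τ H + 4 * τ * I))
  have h2 := hasFDerivAt_regHeight (τ := τ) hH₀ hH₁ (hasDerivAt_mob ha' hz'.le)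
    (normSq_mob_le_one ha' hz'.le)
  have h3 := hasFDerivAt_regHeight (τ := τ) hH₀ hH₁ (hasDerivAt_id z) (normSq_lt_one hz).le
  refine ((h1.add (h2.sub h3)).add_const t).congr_fderiv ?_
  rw [← map_sub, ← map_add]
  congr 1
  have e2 := congrArg ((↑) : ℝ → ℂ) (two_mul_regDensity (τ := τ) hH₀ hH₁ (mob_mem_disk ha hz))
  have e3 := congrArg ((↑) : ℝ → ℂ) (two_mul_regDensity (τ := τ) hH₀ hH₁ hz)
  have key := conf_mob_mul_mob ha hz
  push_cast at e2 e3
  simp only [id, map_mul, map_add, map_div₀, map_neg, map_sub, map_one, conj_I, conj_ofReal,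
    conj_conj, connVec, mul_one, map_ofNat]
  have e4 : (2 * (growthRate τ H : ℂ) + 4 * τ * -I) * (-a / (1 - a * conj z)) =
      (growthRate τ H - 2 * τ * I) * -(2 * a / (1 - a * conj z)) := by
    field_simp
    ring
  rw [e4]
  linear_combination mob a z * conj (mobDeriv a z) * e2 - z * e3 -
    (growthRate τ H - 2 * τ * I) * key

/-! ### Mean curvature -/

/-- The Euclidean divergence of a vector field of the form `conj f' * W ∘ f` with `f` holomorphic:
the factor `conj f'` is antiholomorphic, so it does not contribute. -/
lemma exists_hasFDerivAt_conj_deriv_mul {f f₁ W : ℂ → ℂ} {f₂ z : ℂ} {W' : ℂ →L[ℝ] ℂ}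
    (hf : HasDerivAt f (f₁ z) z) (hf₁ : HasDerivAt f₁ f₂ z) (hW : HasFDerivAt W W' (f z)) :
    ∃ V' : ℂ →L[ℝ] ℂ, HasFDerivAt (fun w => conj (f₁ w) * W (f w)) V' z ∧
      (V' 1).re + (V' I).im = normSq (f₁ z) * ((W' 1).re + (W' I).im) := by
  have h1 := (conjCLE : ℂ →L[ℝ] ℂ).hasFDerivAt.comp z hf₁.complexToReal_fderiv
  have h2 := hW.comp z hf.complexToReal_fderiv
  refine ⟨_, h1.mul h2, ?_⟩
  have hlin : ∀ v : ℂ, W' v = v.re * W' 1 + v.im * W' I := fun v => by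
    rw [← real_smul, ← real_smul, ← map_smul, ← map_smul, ← map_add]
    simp
  simp only [Function.comp_apply, _root_.add_apply, _root_.smul_apply,
    ContinuousLinearMap.comp_apply, _root_.one_apply_eq_self, smul_eq_mul, mul_one,
    ContinuousLinearEquiv.coe_coe, conjCLE_apply]
  rw [hlin (f₁ z), hlin (f₁ z * I)]
  simp [normSq_apply]
  ring

/-- The weighted unit vector field `λ² G / √(1 + ‖G‖²)` of a slice. -/
def sliceField (τ H : ℝ) (z : ℂ) : ℂ :=
  (4 * H / (1 - normSq z) - 4 * τ / ((1 - normSq z) * radialWeight τ H (normSq z)) * I) * z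

lemma exists_hasFDerivAt_radial {A B : ℝ → ℝ} {A' B' : ℝ} {z : ℂ}
    (hA : HasDerivAt A A' (normSq z)) (hB : HasDerivAt B B' (normSq z)) :
    ∃ W' : ℂ →L[ℝ] ℂ,
      HasFDerivAt (fun w => ((A (normSq w) : ℂ) - B (normSq w) * I) * w) W' z ∧
      (W' 1).re + (W' I).im = 2 * (normSq z * A' + A (normSq z)) := by
  have hn := hasFDerivAt_normSq (hasDerivAt_id z)
  simp only [id] at hn
  have hA1 := ofRealCLM.hasFDerivAt.comp z (hA.comp_hasFDerivAt z hn)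
  have hB1 := ofRealCLM.hasFDerivAt.comp z (hB.comp_hasFDerivAt z hn)
  refine ⟨_, (hA1.sub (hB1.mul_const I)).mul (hasFDerivAt_id z), ?_⟩
  simp [normSq_apply, Complex.inner]
  ring

lemma exists_hasFDerivAt_sliceField (hH₀ : 0 < H) (hH₁ : H < 1 / 2) {z : ℂ} (hz : z ∈ disk) :
    ∃ W' : ℂ →L[ℝ] ℂ, HasFDerivAt (sliceField τ H) W' z ∧
      (W' 1).re + (W' I).im = 2 * H * conf z ^ 2 := by
  have h1 : 1 - normSq z ≠ 0 := by linarith [normSq_lt_one hz]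
  have hmem := mem_radialDomain (τ := τ) hH₀ hH₁ (normSq_nonneg z) (normSq_lt_one hz).le
  have hsub : HasDerivAt (fun s : ℝ => 1 - s) (-1) (normSq z) := (hasDerivAt_id _).const_sub 1
  have hA : HasDerivAt (fun s : ℝ => 4 * H / (1 - s)) (4 * H / (1 - normSq z) ^ 2) (normSq z) := by
    refine ((hasDerivAt_const (normSq z) (4 * H)).div hsub h1).congr_deriv ?_
    ring
  have hB : DifferentiableAt ℝ (fun s : ℝ => 4 * τ / ((1 - s) * radialWeight τ H s))
      (normSq z) := by
    refine DifferentiableAt.div (by fun_prop) (hsub.differentiableAt.mul ?_)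
      (mul_ne_zero h1 (radialWeight_pos hmem).ne')
    exact (contDiffOn_radialWeight.contDiffAt (isOpen_radialDomain.mem_nhds hmem)).differentiableAt
      (by simp)
  obtain ⟨W', hW, e⟩ := exists_hasFDerivAt_radial hA hB.hasDerivAt
  refine ⟨W', ?_, ?_⟩
  · refine hW.congr_of_eventuallyEq (Filter.Eventually.of_forall fun w => ?_)
    simp only [sliceField]
    push_cast
    ring
  · rw [e, conf_eq]
    field_simp
    ring

/-- For a slice, `1 + ‖G‖²` is the square of the radial factor. -/
lemma one_add_normSq_connVec (hH₀ : 0 < H) (hH₁ : H < 1 / 2) {z : ℂ} (hz : z ∈ disk) :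
    1 + normSq (connVec τ H z) / conf z ^ 2 = radialWeight τ H (normSq z) ^ 2 := by
  have hmem := mem_radialDomain (τ := τ) hH₀ hH₁ (normSq_nonneg z) (normSq_lt_one hz).le
  have hc := (conf_pos hz).ne'
  have e : normSq (connVec τ H z) = conf z ^ 2 * (normSq z *
      (4 * H ^ 2 * radialWeight τ H (normSq z) ^ 2 + 4 * τ ^ 2)) := by
    rw [connVec, map_mul, map_mul, normSq_ofReal]
    have : normSq (2 * H * radialWeight τ H (normSq z) - 2 * τ * I) =
        4 * H ^ 2 * radialWeight τ H (normSq z) ^ 2 + 4 * τ ^ 2 := by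
      simp [normSq_apply]
      ring
    rw [this]
    ring
  have hρ := sq_radialWeight hmem
  rw [eq_div_iff hmem.2.ne'] at hρ
  rw [e, mul_div_cancel_left₀ _ (pow_ne_zero 2 hc)]
  linear_combination -hρ

lemma differentiableAt_mobDeriv {a z : ℂ} (ha : ‖a‖ < 1) (hz : ‖z‖ ≤ 1) :
    DifferentiableAt ℂ (mobDeriv a) z := by
  unfold mobDeriv
  exact DifferentiableAt.div (by fun_prop) (by fun_prop)
    (pow_ne_zero 2 (one_sub_conj_mul_ne_zero ha hz))

lemma genGrad_tiltedSlice (hH₀ : 0 < H) (hH₁ : H < 1 / 2) {a : ℂ} (ha : a ∈ disk) (t : ℝ)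
    {z : ℂ} (hz : z ∈ disk) :
    genGrad τ H (tiltedSlice τ H a t) z =
      ((conf z ^ 2)⁻¹ : ℝ) • (conj (mobDeriv a z) * connVec τ H (mob a z)) := by
  have h := (hasFDerivAt_tiltedSlice (τ := τ) hH₀ hH₁ ha t hz).fderiv
  rw [genGrad, h, ← re_connVec, ← im_connVec]
  generalize conj (mobDeriv a z) * connVec τ H (mob a z) = G
  generalize conf z ^ 2 = k
  apply Complex.ext
  · simp [Complex.inner]
    ring
  · simp [Complex.inner]
    ring

lemma conf_sq_smul_normalized (hH₀ : 0 < H) (hH₁ : H < 1 / 2) {a : ℂ} (ha : a ∈ disk) (t : ℝ)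
    {z : ℂ} (hz : z ∈ disk) :
    (conf z ^ 2) • ((√(1 + (conf z * ‖genGrad τ H (tiltedSlice τ H a t) z‖) ^ 2))⁻¹ •
      genGrad τ H (tiltedSlice τ H a t) z) =
      conj (mobDeriv a z) * sliceField τ H (mob a z) := by
  have hm := mob_mem_disk ha hz
  have hmem := mem_radialDomain (τ := τ) hH₀ hH₁ (normSq_nonneg _) (normSq_lt_one hm).le
  have hρ := radialWeight_pos hmem
  have hc := (conf_pos hz).ne'
  have hcm := (conf_pos hm).ne'
  have hiso := conf_mob_sq_mul_normSq_mobDeriv ha hz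
  have hsq : 1 + (conf z * ‖genGrad τ H (tiltedSlice τ H a t) z‖) ^ 2 =
      radialWeight τ H (normSq (mob a z)) ^ 2 := by
    rw [← one_add_normSq_connVec hH₀ hH₁ hm, mul_pow, ← normSq_eq_norm_sq,
      genGrad_tiltedSlice hH₀ hH₁ ha t hz, real_smul, map_mul, map_mul, normSq_ofReal, normSq_conj]
    field_simp
    rw [← hiso]
    ring
  rw [hsq, Real.sqrt_sq hρ.le, genGrad_tiltedSlice hH₀ hH₁ ha t hz, smul_smul, smul_smul]
  have e : conf z ^ 2 * (radialWeight τ H (normSq (mob a z)))⁻¹ * (conf z ^ 2)⁻¹ =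
      (radialWeight τ H (normSq (mob a z)))⁻¹ := by
    field_simp
  have hρ' : (radialWeight τ H (normSq (mob a z)) : ℂ) ≠ 0 := by exact_mod_cast hρ.ne'
  have hd : (1 : ℂ) - normSq (mob a z) ≠ 0 := by
    have : 1 - normSq (mob a z) ≠ 0 := by linarith [normSq_lt_one hm]
    exact_mod_cast this
  rw [e, real_smul, connVec, sliceField, conf_eq]
  push_cast
  field_simp
  ring

lemma isEntireHGraph_tiltedSlice (hH₀ : 0 < H) (hH₁ : H < 1 / 2) {a : ℂ} (ha : a ∈ disk) (t : ℝ) :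
    IsEntireHGraph τ H (tiltedSlice τ H a t) := by
  refine ⟨fun z hz => (contDiffAt_tiltedSlice hH₀ hH₁ (mem_disk.1 ha) t
    (mem_disk.1 hz).le).contDiffWithinAt, fun z hz => ?_⟩
  have hm := mob_mem_disk ha hz
  have ha' := mem_disk.1 ha
  have hz' := (mem_disk.1 hz).le
  obtain ⟨W', hW, eW⟩ := exists_hasFDerivAt_sliceField (τ := τ) hH₀ hH₁ hm
  obtain ⟨V', hV, eV⟩ := exists_hasFDerivAt_conj_deriv_mul (hasDerivAt_mob ha' hz')
    (differentiableAt_mobDeriv ha' hz').hasDerivAt hW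
  have hev : ∀ᶠ w in nhds z, w ∈ disk := isOpen_disk.mem_nhds hz
  have hre := (reCLM.hasFDerivAt.comp z hV).congr_of_eventuallyEq (f₁ := fun w => conf w ^ 2 *
      ((√(1 + (conf w * ‖genGrad τ H (tiltedSlice τ H a t) w‖) ^ 2))⁻¹ •
        genGrad τ H (tiltedSlice τ H a t) w).re) <| hev.mono fun w hw => by
    rw [Function.comp_apply, ← conf_sq_smul_normalized hH₀ hH₁ ha t hw, reCLM_apply,
      Complex.smul_re (conf w ^ 2), smul_eq_mul]
  have him := (imCLM.hasFDerivAt.comp z hV).congr_of_eventuallyEq (f₁ := fun w => conf w ^ 2 *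
      ((√(1 + (conf w * ‖genGrad τ H (tiltedSlice τ H a t) w‖) ^ 2))⁻¹ •
        genGrad τ H (tiltedSlice τ H a t) w).im) <| hev.mono fun w hw => by
    rw [Function.comp_apply, ← conf_sq_smul_normalized hH₀ hH₁ ha t hw, imCLM_apply,
      Complex.smul_im (conf w ^ 2), smul_eq_mul]
  rw [meanCurvature, hypDiv, hre.fderiv, him.fderiv]
  simp only [ContinuousLinearMap.comp_apply, reCLM_apply, imCLM_apply]
  have hiso := conf_mob_sq_mul_normSq_mobDeriv ha hz
  have hc := pow_ne_zero 2 (conf_pos hz).ne'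
  rw [eV, eW, ← hiso]
  rw [← hiso] at hc
  rw [div_div, div_eq_iff (mul_ne_zero hc two_ne_zero)]
  ring

/-! ### Isometries and rotations -/

lemma isOpen_cylinder : IsOpen cylinder := isOpen_disk.preimage continuous_fst

lemma connForm_eq (z : ℂ) (v : ℂ × ℝ) : connForm τ H z v = inner ℝ (connVec τ H z) v.1 + v.2 := by
  simp only [connForm, Complex.inner, mul_re, conj_re, conj_im, re_connVec, im_connVec]
  ring

lemma metric_eq (p v w : ℂ × ℝ) : metric τ H p v w =
    conf p.1 ^ 2 * inner ℝ v.1 w.1 + connForm τ H p.1 v * connForm τ H p.1 w := by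
  simp only [metric, Complex.inner, mul_re, conj_re, conj_im]
  ring

lemma inner_mul_mul (c v w : ℂ) : inner ℝ (c * v) (c * w) = normSq c * inner ℝ v w := by
  simp only [Complex.inner, mul_re, mul_im, conj_re, conj_im, normSq_apply, map_mul]
  ring

lemma inner_conj_mul (c v w : ℂ) : inner ℝ (conj c * v) w = inner ℝ v (c * w) := by
  simp only [Complex.inner, mul_re, mul_im, conj_re, conj_im, map_mul, conj_conj]
  ring

/-- A hyperbolic isometry of the disk, together with a potential of the difference between the
connection form and its pullback, gives an isometry of the model. -/
lemma isIsom_skew {m m' : ℂ → ℂ} {φ : ℂ → ℝ} (hm : BijOn m disk disk)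
    (hsm : ContDiffOn ℝ ∞ m disk) (hsφ : ContDiffOn ℝ ∞ φ disk)
    (hm' : ∀ z ∈ disk, HasDerivAt m (m' z) z)
    (hφ : ∀ z ∈ disk, HasFDerivAt φ
      (innerSL ℝ (connVec τ H z - conj (m' z) * connVec τ H (m z))) z)
    (hconf : ∀ z ∈ disk, conf (m z) ^ 2 * normSq (m' z) = conf z ^ 2) :
    IsIsom τ H (fun p => (m p.1, p.2 + φ p.1)) where
  bijOn := by
    refine ⟨fun p hp => hm.mapsTo hp, fun p hp p' hp' h => ?_, fun p hp => ?_⟩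
    · obtain ⟨h1, h2⟩ := Prod.ext_iff.1 h
      have h3 := hm.injOn hp hp' h1
      simp only [h3, add_left_inj] at h2
      exact Prod.ext h3 h2
    · obtain ⟨z, hz, e⟩ := hm.surjOn hp
      exact ⟨(z, p.2 - φ z), hz, by simp [e]⟩
  smooth := by
    have hmaps : MapsTo Prod.fst cylinder disk := fun p hp => hp
    exact (hsm.comp contDiffOn_fst hmaps).prodMk
      (contDiffOn_snd.add (hsφ.comp contDiffOn_fst hmaps))
  preserves := by
    intro p hp v w
    have hp1 : p.1 ∈ disk := hp
    have h1 := (hm' p.1 hp1).complexToReal_fderiv.comp p hasFDerivAt_fst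
    have h2 : HasFDerivAt (fun p : ℂ × ℝ => p.2 + φ p.1) _ p :=
      (hasFDerivAt_snd (𝕜 := ℝ) (p := p)).add ((hφ p.1 hp1).comp p hasFDerivAt_fst)
    have hD := (h1.prodMk h2).fderiv
    simp only [Function.comp_def] at hD
    have key : ∀ v : ℂ × ℝ, connForm τ H (m p.1) (m' p.1 * v.1,
        v.2 + inner ℝ (connVec τ H p.1 - conj (m' p.1) * connVec τ H (m p.1)) v.1) =
        connForm τ H p.1 v := fun v => by
      rw [connForm_eq, connForm_eq, inner_sub_left, inner_conj_mul]
      ring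
    have hDv : ∀ v : ℂ × ℝ, fderiv ℝ (fun p : ℂ × ℝ => (m p.1, p.2 + φ p.1)) p v =
        (m' p.1 * v.1,
          v.2 + inner ℝ (connVec τ H p.1 - conj (m' p.1) * connVec τ H (m p.1)) v.1) := fun v => by
      rw [hD]
      rfl
    rw [hDv, hDv, metric_eq, metric_eq, key, key]
    dsimp only
    rw [inner_mul_mul, ← mul_assoc, hconf p.1 hp1]

lemma IsIsom.hasFDerivAt {Φ : ℂ × ℝ → ℂ × ℝ} (h : IsIsom τ H Φ) {p : ℂ × ℝ} (hp : p ∈ cylinder) :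
    HasFDerivAt Φ (fderiv ℝ Φ p) p :=
  ((h.smooth.contDiffAt (isOpen_cylinder.mem_nhds hp)).differentiableAt (by simp)).hasFDerivAt

lemma IsIsom.comp {Φ Ψ : ℂ × ℝ → ℂ × ℝ} (hΨ : IsIsom τ H Ψ) (hΦ : IsIsom τ H Φ) :
    IsIsom τ H (Ψ ∘ Φ) where
  bijOn := hΨ.bijOn.comp hΦ.bijOn
  smooth := hΨ.smooth.comp hΦ.smooth hΦ.bijOn.mapsTo
  preserves := fun p hp v w => by
    rw [((hΨ.hasFDerivAt (hΦ.bijOn.mapsTo hp)).comp p (hΦ.hasFDerivAt hp)).fderiv]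
    exact (hΨ.preserves _ (hΦ.bijOn.mapsTo hp) _ _).trans (hΦ.preserves p hp v w)

lemma IsIsom.of_invOn {Φ Ψ : ℂ × ℝ → ℂ × ℝ} (hΦ : IsIsom τ H Φ)
    (hΨ : ContDiffOn ℝ ∞ Ψ cylinder) (hmaps : MapsTo Ψ cylinder cylinder)
    (hinv : InvOn Ψ Φ cylinder cylinder) : IsIsom τ H Ψ where
  bijOn := hinv.symm.bijOn hmaps hΦ.bijOn.mapsTo
  smooth := hΨ
  preserves := fun p hp v w => by
    have hd : HasFDerivAt Ψ (fderiv ℝ Ψ p) p :=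
      ((hΨ.contDiffAt (isOpen_cylinder.mem_nhds hp)).differentiableAt (by simp)).hasFDerivAt
    have hc := (hΦ.hasFDerivAt (hmaps hp)).comp p hd
    have hid : HasFDerivAt (Φ ∘ Ψ) (ContinuousLinearMap.id ℝ (ℂ × ℝ)) p :=
      (hasFDerivAt_id p).congr_of_eventuallyEq
        ((isOpen_cylinder.eventually_mem hp).mono fun q hq => hinv.2 hq)
    have e : ∀ v, fderiv ℝ Φ (Ψ p) (fderiv ℝ Ψ p v) = v := fun v =>
      DFunLike.congr_fun (hc.unique hid) v
    rw [← hΦ.preserves _ (hmaps hp), e, e, hinv.2 hp]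

/-- The isometry that takes the graph of `tiltedSlice τ H a t` to the slice at height `0`. -/
def straighten (τ H : ℝ) (a : ℂ) (t : ℝ) (p : ℂ × ℝ) : ℂ × ℝ :=
  (mob a p.1, p.2 + -tiltedSlice τ H a t p.1)

/-- The inverse of `straighten`. -/
def unstraighten (τ H : ℝ) (a : ℂ) (t : ℝ) (p : ℂ × ℝ) : ℂ × ℝ :=
  (mob (-a) p.1, p.2 + tiltedSlice τ H a t (mob (-a) p.1))

/-- The rotation of the model about the vertical axis over the origin. -/
def axialRotation (θ : Circle) (p : ℂ × ℝ) : ℂ × ℝ := ((θ : ℂ) * p.1, p.2 + 0)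

lemma mob_mob_neg {a z : ℂ} (ha : a ∈ disk) (hz : z ∈ disk) : mob a (mob (-a) z) = z := by
  have h := mob_neg_mob (neg_mem_disk ha) hz
  rwa [neg_neg] at h

lemma bijOn_mob {a : ℂ} (ha : a ∈ disk) : BijOn (mob a) disk disk :=
  InvOn.bijOn (f' := mob (-a)) ⟨fun _ hz => mob_neg_mob ha hz, fun _ hz => mob_mob_neg ha hz⟩
    (fun _ hz => mob_mem_disk ha hz) (fun _ hz => mob_mem_disk (neg_mem_disk ha) hz)

lemma contDiffOn_mob {a : ℂ} (ha : a ∈ disk) : ContDiffOn ℝ ∞ (mob a) disk := fun _ hz =>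
  (contDiffAt_mob (mem_disk.1 ha) (mem_disk.1 hz).le).contDiffWithinAt

lemma isIsom_straighten (hH₀ : 0 < H) (hH₁ : H < 1 / 2) {a : ℂ} (ha : a ∈ disk) (t : ℝ) :
    IsIsom τ H (straighten τ H a t) := by
  refine isIsom_skew (bijOn_mob ha) (contDiffOn_mob ha)
    (isEntireHGraph_tiltedSlice hH₀ hH₁ ha t).1.neg
    (fun z hz => hasDerivAt_mob (mem_disk.1 ha) (mem_disk.1 hz).le) (fun z hz => ?_)
    fun z hz => conf_mob_sq_mul_normSq_mobDeriv ha hz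
  refine (hasFDerivAt_tiltedSlice hH₀ hH₁ ha t hz).neg.congr_fderiv ?_
  rw [← map_neg, neg_sub]

lemma invOn_unstraighten {a : ℂ} (ha : a ∈ disk) (t : ℝ) :
    InvOn (unstraighten τ H a t) (straighten τ H a t) cylinder cylinder := by
  refine ⟨fun p hp => ?_, fun p hp => ?_⟩
  · have hp : p.1 ∈ disk := hp
    simp [straighten, unstraighten, mob_neg_mob ha hp]
  · have hp : p.1 ∈ disk := hp
    simp [straighten, unstraighten, mob_mob_neg ha hp]

lemma isIsom_unstraighten (hH₀ : 0 < H) (hH₁ : H < 1 / 2) {a : ℂ} (ha : a ∈ disk) (t : ℝ) :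
    IsIsom τ H (unstraighten τ H a t) := by
  have hmaps : MapsTo (fun p : ℂ × ℝ => mob (-a) p.1) cylinder disk :=
    fun p hp => mob_mem_disk (neg_mem_disk ha) hp
  have hs : ContDiffOn ℝ ∞ (fun p : ℂ × ℝ => mob (-a) p.1) cylinder :=
    (contDiffOn_mob (neg_mem_disk ha)).comp contDiffOn_fst fun p hp => hp
  exact (isIsom_straighten hH₀ hH₁ ha t).of_invOn
    (hs.prodMk (contDiffOn_snd.add ((isEntireHGraph_tiltedSlice hH₀ hH₁ ha t).1.comp hs hmaps)))
    hmaps (invOn_unstraighten ha t)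

lemma normSq_circle_mul (θ : Circle) (z : ℂ) : normSq ((θ : ℂ) * z) = normSq z := by
  simp

lemma circle_mul_mem_disk {θ : Circle} {z : ℂ} (hz : z ∈ disk) : (θ : ℂ) * z ∈ disk := by
  rw [mem_disk] at *
  rwa [norm_mul, Circle.norm_coe, one_mul]

lemma isIsom_axialRotation (θ : Circle) : IsIsom τ H (axialRotation θ) := by
  have hconf : ∀ z : ℂ, conf ((θ : ℂ) * z) = conf z := fun z => by
    rw [conf_eq, conf_eq, normSq_circle_mul]
  have hθ : conj (θ : ℂ) * θ = 1 := by
    rw [mul_comm, mul_conj]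
    simp
  refine isIsom_skew (m := fun z => (θ : ℂ) * z) (m' := fun _ => (θ : ℂ)) (φ := fun _ => 0) ?_
    (by fun_prop) (by fun_prop) (fun z _ => ?_) (fun z _ => ?_) (fun z _ => ?_)
  · refine InvOn.bijOn (f' := fun z => ((θ⁻¹ : Circle) : ℂ) * z)
      ⟨fun z _ => ?_, fun z _ => ?_⟩ (fun z hz => circle_mul_mem_disk hz)
      (fun z hz => circle_mul_mem_disk hz)
    · simp
    · simp
  · exact ((hasDerivAt_id z).const_mul (θ : ℂ)).congr_deriv (mul_one _)
  · refine (hasFDerivAt_const (0 : ℝ) z).congr_fderiv ?_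
    have : connVec τ H z - conj (θ : ℂ) * connVec τ H (θ * z) = 0 := by
      rw [connVec, connVec, hconf, normSq_circle_mul]
      linear_combination -(conf z * z * (2 * H * radialWeight τ H (normSq z) - 2 * τ * I)) * hθ
    rw [this, map_zero]
  · rw [hconf]
    simp

/-- The rotations about the vertical axis over `a`, conjugated from those over the origin. -/
def rotation (τ H : ℝ) (a : ℂ) (t : ℝ) (θ : Circle) : ℂ × ℝ → ℂ × ℝ :=
  unstraighten τ H a t ∘ axialRotation θ ∘ straighten τ H a t

lemma isRotationGroup_rotation (hH₀ : 0 < H) (hH₁ : H < 1 / 2) {a : ℂ} (ha : a ∈ disk) (t : ℝ) :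
    IsRotationGroup τ H a (rotation τ H a t) := by
  have hS := isIsom_straighten (τ := τ) hH₀ hH₁ ha t
  have hU := isIsom_unstraighten (τ := τ) hH₀ hH₁ ha t
  have hinv := invOn_unstraighten (τ := τ) (H := H) ha t
  have hrot : ∀ θ p, p ∈ cylinder → axialRotation θ p ∈ cylinder := fun θ p hp =>
    (isIsom_axialRotation (τ := τ) (H := H) θ).bijOn.mapsTo hp
  refine ⟨fun θ => hU.comp ((isIsom_axialRotation θ).comp hS), fun p hp => ?_,
    fun θ θ' p hp => ?_, ?_, fun θ s => ?_, fun θ hθ => ?_⟩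
  · have : axialRotation 1 (straighten τ H a t p) = straighten τ H a t p := by
      simp [axialRotation]
    simp only [rotation, Function.comp_apply, this, hinv.1 hp]
  · simp only [rotation, Function.comp_apply]
    rw [hinv.2 (hrot θ' _ (hS.bijOn.mapsTo hp))]
    simp [axialRotation, mul_assoc]
  · have hmaps : MapsTo Prod.snd ((univ : Set Circle) ×ˢ cylinder) cylinder := fun x hx => hx.2
    have h1 : ContinuousOn (fun x : Circle × (ℂ × ℝ) => (x.1, straighten τ H a t x.2))
        (univ ×ˢ cylinder) :=
      continuousOn_fst.prodMk (hS.smooth.continuousOn.comp continuousOn_snd hmaps)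
    have h2 : Continuous (fun x : Circle × (ℂ × ℝ) => axialRotation x.1 x.2) := by
      unfold axialRotation
      fun_prop
    exact hU.smooth.continuousOn.comp (h2.comp_continuousOn h1)
      fun x hx => hrot _ _ (hS.bijOn.mapsTo hx.2)
  · have h0 : mob a a = 0 := by simp [mob]
    have h1 : mob (-a) 0 = a := by simp [mob]
    simp [rotation, straighten, unstraighten, axialRotation, h0, h1]
  · have hp : ((1 / 2 : ℂ), (0 : ℝ)) ∈ cylinder := by
      change (1 / 2 : ℂ) ∈ disk
      rw [mem_disk]
      norm_num
    have hq := hU.bijOn.mapsTo hp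
    have h := congrArg (straighten τ H a t) (hθ _ hq)
    simp only [rotation, Function.comp_apply] at h
    rw [hinv.2 hp, hinv.2 (hrot θ _ hp)] at h
    have h1 : (θ : ℂ) * (1 / 2) = 1 / 2 := congrArg Prod.fst h
    apply Circle.ext
    rw [Circle.coe_one]
    linear_combination 2 * h1

lemma mem_graph_tiltedSlice_iff {a : ℂ} (t : ℝ) {p : ℂ × ℝ} (hp : p ∈ cylinder) :
    p ∈ graph (tiltedSlice τ H a t) ↔ (straighten τ H a t p).2 = 0 := by
  have hp' : p.1 ∈ disk := hp
  simp [graph, straighten, hp', ← sub_eq_add_neg, sub_eq_zero]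

lemma isRotationallyInvariant_tiltedSlice (hH₀ : 0 < H) (hH₁ : H < 1 / 2) {a : ℂ} (ha : a ∈ disk)
    (t : ℝ) : IsRotationallyInvariant τ H a (graph (tiltedSlice τ H a t)) := by
  have hR := isRotationGroup_rotation (τ := τ) hH₀ hH₁ ha t
  refine ⟨ha, rotation τ H a t, hR, ?_⟩
  have hmaps : ∀ θ, MapsTo (rotation τ H a t θ) (graph (tiltedSlice τ H a t))
      (graph (tiltedSlice τ H a t)) := fun θ p hp => by
    have hp1 : p ∈ cylinder := hp.1
    have hq := (hR.isom θ).bijOn.mapsTo hp1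
    rw [mem_graph_tiltedSlice_iff t hp1] at hp
    rw [mem_graph_tiltedSlice_iff t hq]
    have hmem := (isIsom_axialRotation (τ := τ) (H := H) θ).bijOn.mapsTo
      ((isIsom_straighten (τ := τ) hH₀ hH₁ ha t).bijOn.mapsTo hp1)
    have e := (invOn_unstraighten (τ := τ) (H := H) ha t).2 hmem
    simp only [rotation, Function.comp_apply]
    rw [e]
    simpa [axialRotation] using hp
  intro θ
  refine Subset.antisymm (hmaps θ).image_subset fun p hp => ?_
  refine ⟨rotation τ H a t θ⁻¹ p, hmaps _ hp, ?_⟩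
  rw [← hR.map_mul _ _ p hp.1, mul_inv_cancel, hR.map_one p hp.1]

/-! ### Comparison of boundary values -/

lemma sq_div_two_le_mul_sin {s : ℝ} (hs : |s| ≤ 1) : s ^ 2 / 2 ≤ s * Real.sin s := by
  have main : ∀ x : ℝ, 0 < x → x ≤ 1 → x ^ 2 / 2 ≤ x * Real.sin x := fun x h0 h1 => by
    have := Real.sin_gt_sub_cube h0
    nlinarith [pow_pos h0 3, mul_pos h0 h0]
  rcases lt_trichotomy s 0 with h | h | h
  · have := main (-s) (by linarith) ((neg_le_abs s).trans hs)
    rw [Real.sin_neg] at this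
    linarith
  · simp [h]
  · exact main s h ((le_abs_self s).trans hs)

/-- With `ζ = X + i Y` on the line `Y = α + β X` and `L = |ζ|²`, the inequality compares the
logarithmic-type boundary profile near its base point with a function having the same slope there
and second derivative of size `C`. The term `s * sin s * L` dominates because `L` is quadratic in
`X` and the other terms of order `s²` are linear. -/
lemma exists_slope_comparison (α β : ℝ) {C : ℝ} (hC : 0 ≤ C) :
    ∃ δ X₀ : ℝ, 0 < δ ∧ δ ≤ 1 ∧ ∀ X Y L : ℝ, X₀ ≤ X → Y = α + β * X → L = X ^ 2 + Y ^ 2 →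
      ∀ s : ℝ, s ≠ 0 → |s| ≤ δ →
        (α * s + C * s ^ 2) * (1 + 2 * (1 - Real.cos s) * (X + L) + 2 * Real.sin s * Y) <
          s * ((X + L + β * Y) * Real.sin s + α * Real.cos s + β * L * (1 - Real.cos s)) := by
  obtain ⟨A, hA⟩ : ∃ A, A = 1 + |β| + 2 * |α| + 2 * C := ⟨_, rfl⟩
  obtain ⟨B, hB⟩ : ∃ B, B = |α| + |β| := ⟨_, rfl⟩
  have hα := abs_nonneg α
  have hβ := abs_nonneg β
  have hA1 : 1 ≤ A := by linarith
  have hB0 : 0 ≤ B := by linarith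
  refine ⟨1 / (8 * A), 4 * A * (B + 1), by positivity, ?_, ?_⟩
  · rw [div_le_one (by positivity)]
    linarith
  intro X Y L hX hY hL s hs0 hs
  have hX1 : 1 ≤ X := by nlinarith [mul_nonneg (by linarith : 0 ≤ A) hB0]
  have hY1 : |Y| ≤ B * X := by
    rw [hY, hB]
    refine (abs_add_le _ _).trans ?_
    rw [abs_mul, abs_of_nonneg (by linarith : 0 ≤ X)]
    nlinarith
  have hLX : X ^ 2 ≤ L := by rw [hL]; nlinarith [sq_nonneg Y]
  have hXL : X ≤ L := by nlinarith
  have hYL : A * (|Y| + 1) ≤ L / 4 := by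
    have h1 : A * (|Y| + 1) ≤ A * (B + 1) * X := by
      rw [mul_assoc]
      exact mul_le_mul_of_nonneg_left (by linarith) (by linarith)
    nlinarith
  have hsA : |s| * A ≤ 1 / 8 := by
    have := mul_le_mul_of_nonneg_right hs (by linarith : 0 ≤ A)
    refine this.trans (le_of_eq ?_)
    field_simp
  have hs1 : |s| ≤ 1 := by nlinarith [abs_nonneg s]
  have hss := sq_abs s
  have hsn := abs_nonneg s
  have hsin := sq_div_two_le_mul_sin hs1
  have hsin' : |Real.sin s| ≤ |s| := Real.abs_sin_le_abs
  obtain ⟨κ, hκ⟩ : ∃ κ, κ = 1 - Real.cos s := ⟨_, rfl⟩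
  have hcos : Real.cos s = 1 - κ := by linarith
  have hκ0 : 0 ≤ κ := by linarith [Real.cos_le_one s]
  have hκ1 : κ ≤ s ^ 2 / 2 := by linarith [Real.one_sub_sq_div_two_le_cos (x := s)]
  rw [hcos]
  generalize Real.sin s = S at *
  have hs2 : 0 < s ^ 2 := by positivity
  have hL0 : 0 < L := by linarith
  have b1 : s ^ 2 / 2 * L ≤ s * S * (X + L) :=
    mul_le_mul hsin (by linarith) hL0.le (by linarith [hsin, hs2])
  have b2 : |s * S * (β - 2 * α) * Y| ≤ s ^ 2 * ((|β| + 2 * |α|) * |Y|) := by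
    rw [abs_mul, abs_mul, abs_mul, mul_assoc]
    have h1 : |s| * |S| ≤ s ^ 2 := by
      rw [← hss, sq]
      exact mul_le_mul_of_nonneg_left hsin' hsn
    have h2 : |β - 2 * α| ≤ |β| + 2 * |α| := by
      refine (abs_sub β (2 * α)).trans ?_
      rw [abs_mul, abs_two]
    exact mul_le_mul h1 (mul_le_mul_of_nonneg_right h2 (abs_nonneg Y)) (by positivity) hs2.le
  have b3 : |s * (β * L - α - 2 * α * (X + L)) * κ| ≤
      |s| * (|β| * L + |α| + 4 * |α| * L) * (s ^ 2 / 2) := by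
    rw [abs_mul, abs_mul, abs_of_nonneg hκ0]
    have h2 : |β * L - α - 2 * α * (X + L)| ≤ |β| * L + |α| + 4 * |α| * L := by
      refine (abs_sub _ _).trans ?_
      have h3 := abs_sub (β * L) α
      rw [abs_mul, abs_of_pos hL0] at h3
      rw [abs_mul, abs_mul, abs_two, abs_of_pos (by linarith : 0 < X + L)]
      have h4 : |α| * (X + L) ≤ |α| * (2 * L) := mul_le_mul_of_nonneg_left (by linarith) hα
      linarith
    exact mul_le_mul (mul_le_mul_of_nonneg_left h2 hsn) hκ1 hκ0 (by positivity)
  have b4 : 1 + 2 * κ * (X + L) + 2 * S * Y ≤ 1 + 2 * |s| * L + 2 * |Y| := by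
    have h1 : 2 * κ * (X + L) ≤ 2 * |s| * L := by
      have h0 : κ ≤ |s| / 2 := by
        have : s ^ 2 ≤ |s| := by
          rw [← hss, sq]
          exact mul_le_of_le_one_left hsn hs1
        linarith
      have := mul_le_mul h0 (by linarith : X + L ≤ 2 * L) (by linarith) (by linarith)
      linarith
    have h2 : S * Y ≤ |Y| := by
      refine (le_abs_self _).trans ?_
      rw [abs_mul]
      exact mul_le_of_le_one_left (abs_nonneg Y) (hsin'.trans hs1)
    linarith
  have b5 := mul_le_mul_of_nonneg_left b4 (by positivity : 0 ≤ C * s ^ 2)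
  have b2' := neg_le_of_abs_le b2
  have b3' := neg_le_of_abs_le b3
  have key : 0 < s ^ 2 * (L / 2 - (|β| + 2 * |α|) * |Y| -
      |s| * (|β| * L + |α| + 4 * |α| * L) / 2 - C * (1 + 2 * |s| * L + 2 * |Y|)) := by
    refine mul_pos hs2 ?_
    have h1 : |s| * A * L ≤ 1 / 8 * L := mul_le_mul_of_nonneg_right hsA hL0.le
    have h2 : |s| * |α| ≤ |α| := mul_le_of_le_one_left hα hs1
    have h3 : 0 ≤ |s| * L * |β| := by positivity
    have h4 : 0 ≤ |s| * L := by positivity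
    have h5 : 0 ≤ |α| * |Y| := by positivity
    have h6 := abs_nonneg Y
    rw [hA] at h1 hYL
    linarith
  linarith

lemma lt_of_mul_deriv_pos {F F' : ℝ → ℝ} {δ : ℝ} (hF : ∀ s, HasDerivAt F (F' s) s)
    (h : ∀ s, s ≠ 0 → |s| ≤ δ → 0 < s * F' s) {s : ℝ} (hs0 : s ≠ 0) (hs : |s| ≤ δ) :
    F 0 < F s := by
  have hc : Continuous F := continuous_iff_continuousAt.2 fun x => (hF x).continuousAt
  rcases lt_or_gt_of_ne hs0 with h0 | h0
  · have hanti : StrictAntiOn F (Icc s 0) := by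
      refine strictAntiOn_of_deriv_neg (convex_Icc s 0) hc.continuousOn fun x hx => ?_
      rw [interior_Icc] at hx
      rw [(hF x).deriv]
      have := h x hx.2.ne (by rw [abs_of_neg hx.2]; rw [abs_of_neg h0] at hs; linarith [hx.1])
      exact neg_of_mul_pos_right this hx.2.le
    exact hanti ⟨le_rfl, h0.le⟩ ⟨h0.le, le_rfl⟩ h0
  · have hmono : StrictMonoOn F (Icc 0 s) := by
      refine strictMonoOn_of_deriv_pos (convex_Icc 0 s) hc.continuousOn fun x hx => ?_
      rw [interior_Icc] at hx
      rw [(hF x).deriv]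
      have := h x hx.1.ne' (by rw [abs_of_pos hx.1]; rw [abs_of_pos h0] at hs; linarith [hx.2])
      exact pos_of_mul_pos_right this hx.1.le
    exact hmono ⟨le_rfl, h0.le⟩ ⟨h0.le, le_rfl⟩ h0

/-- The boundary values of `tiltedSlice`, up to an additive constant, at the angle `s` from the
base point `q`; here `b = ā q` and the coefficient is `2 k (1 - i β)`. -/
def profile (k β : ℝ) (b : ℂ) (s : ℝ) : ℝ :=
  (2 * k * (1 - β * I) * log (1 - b * exp (s * I))).re

/-- The point of the line `Im = m / (2 k) + β Re` with real part `X`. When `ζ = b / (1 - b)`, this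
line is the locus where `profile k β b` has derivative `m` at `0`. -/
def slopeLine (k β m X : ℝ) : ℂ := ⟨X, m / (2 * k) + β * X⟩

section

variable {k β m : ℝ}

lemma one_add_ne_zero_of_re {ζ : ℂ} (hζ : 0 < ζ.re) : 1 + ζ ≠ 0 := by
  intro h
  have := congrArg re h
  simp at this
  linarith

lemma norm_div_one_add_lt {ζ : ℂ} (hζ : 0 < ζ.re) : ‖ζ / (1 + ζ)‖ < 1 := by
  rw [norm_div, div_lt_one (norm_pos_iff.2 (one_add_ne_zero_of_re hζ))]
  apply lt_of_pow_lt_pow_left₀ 2 (norm_nonneg _)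
  rw [← normSq_eq_norm_sq, ← normSq_eq_norm_sq, normSq_apply, normSq_apply]
  simp
  nlinarith

lemma norm_mul_exp_lt {b : ℂ} (hb : ‖b‖ < 1) (s : ℝ) : ‖b * exp (s * I)‖ < 1 := by
  rwa [norm_mul, norm_exp_ofReal_mul_I, mul_one]

/-- The ratio `(1 - b e^{is}) / (1 - b)`, in terms of `ζ = b / (1 - b)`. -/
lemma one_sub_mul_exp {ζ : ℂ} (hζ : 0 < ζ.re) (e : ℂ) :
    1 - ζ / (1 + ζ) * e = (1 + (1 - e) * ζ) / (1 + ζ) := by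
  have := one_add_ne_zero_of_re hζ
  field_simp
  ring

lemma normSq_one_add_mul (ζ : ℂ) (s : ℝ) : normSq (1 + (1 - exp (s * I)) * ζ) =
    1 + 2 * (1 - Real.cos s) * (ζ.re + (ζ.re ^ 2 + ζ.im ^ 2)) + 2 * Real.sin s * ζ.im := by
  simp only [normSq_apply, add_re, add_im, mul_re, mul_im, sub_re, sub_im, one_re, one_im,
    exp_ofReal_mul_I_re, exp_ofReal_mul_I_im]
  linear_combination (ζ.re ^ 2 + ζ.im ^ 2) * Real.sin_sq_add_cos_sq s

lemma hasDerivAt_profile {ζ : ℂ} (hζ : 0 < ζ.re) (hm : ζ.im = m / (2 * k) + β * ζ.re)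
    (s : ℝ) : HasDerivAt (profile k β (ζ / (1 + ζ)))
      (2 * k * ((ζ.re + (ζ.re ^ 2 + ζ.im ^ 2) + β * ζ.im) * Real.sin s +
        m / (2 * k) * Real.cos s + β * (ζ.re ^ 2 + ζ.im ^ 2) * (1 - Real.cos s)) /
        normSq (1 + (1 - exp (s * I)) * ζ)) s := by
  have hb := norm_mul_exp_lt (norm_div_one_add_lt hζ) s
  have h1 : HasDerivAt (fun s : ℝ => exp (s * I)) (exp (s * I) * I) s := by
    have := (((hasDerivAt_id (s : ℂ)).mul_const I).cexp).comp_ofReal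
    simpa using this
  have h2 : HasDerivAt (fun s : ℝ => 1 - ζ / (1 + ζ) * exp (s * I))
      (-(ζ / (1 + ζ) * (exp (s * I) * I))) s := (h1.const_mul _).const_sub 1
  have h3 := (h2.clog_real (one_sub_mem_slitPlane hb)).const_mul (2 * k * (1 - β * I) : ℂ)
  refine (reCLM.hasFDerivAt.comp_hasDerivAt s h3).congr_deriv ?_
  have hN : 1 + (1 - exp (s * I)) * ζ ≠ 0 := by
    have := slitPlane_ne_zero (one_sub_mem_slitPlane hb)
    rw [one_sub_mul_exp hζ] at this
    exact (div_ne_zero_iff.1 this).1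
  have h0 := one_add_ne_zero_of_re hζ
  rw [one_sub_mul_exp hζ, div_div_eq_mul_div]
  have e1 : -(ζ / (1 + ζ) * (exp (s * I) * I)) * (1 + ζ) = -(ζ * (exp (s * I) * I)) := by
    field_simp
  rw [e1, reCLM_apply, mul_div_assoc', div_eq_mul_inv, Complex.inv_def, ← mul_assoc, re_mul_ofReal,
    ← div_eq_mul_inv]
  congr 1
  have hm' : m / (2 * k) = ζ.im - β * ζ.re := by linarith
  rw [hm']
  simp only [add_re, add_im, mul_re, mul_im, sub_re, sub_im, one_re, one_im, neg_re, neg_im,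
    exp_ofReal_mul_I_re, exp_ofReal_mul_I_im, I_re, I_im, ofReal_re, ofReal_im, conj_re, conj_im,
    re_ofNat, im_ofNat]
  linear_combination (2 * k * β * (ζ.re ^ 2 + ζ.im ^ 2)) * Real.sin_sq_add_cos_sq s

lemma le_profile_sub (hk : 0 < k) {ζ : ℂ} (hζ : 0 < ζ.re) (s : ℝ) :
    2 * k * (Real.log ‖1 + (1 - exp (s * I)) * ζ‖ - 2 * Real.pi * |β|) ≤
      profile k β (ζ / (1 + ζ)) s - profile k β (ζ / (1 + ζ)) 0 := by
  have h0 := one_add_ne_zero_of_re hζ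
  have hN : 1 + (1 - exp (s * I)) * ζ ≠ 0 := by
    have := slitPlane_ne_zero (one_sub_mem_slitPlane (norm_mul_exp_lt (norm_div_one_add_lt hζ) s))
    rw [one_sub_mul_exp hζ] at this
    exact (div_ne_zero_iff.1 this).1
  have hre : ∀ w : ℂ, (2 * k * (1 - β * I) * log w).re = 2 * k * (Real.log ‖w‖ + β * arg w) :=
    fun w => by
      simp [log_re, log_im]
      ring
  simp only [profile, one_sub_mul_exp hζ]
  rw [hre, hre, ← mul_sub]
  refine mul_le_mul_of_nonneg_left ?_ (by positivity)
  simp only [ofReal_zero, zero_mul, Complex.exp_zero, sub_self, add_zero, norm_div, norm_one]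
  rw [Real.log_div (norm_ne_zero_iff.2 hN) (norm_ne_zero_iff.2 h0),
    Real.log_div one_ne_zero (norm_ne_zero_iff.2 h0), Real.log_one]
  generalize (1 + (1 - exp (s * I)) * ζ) / (1 + ζ) = w
  generalize 1 / (1 + ζ) = w'
  have h1 : |β * (arg w - arg w')| ≤ 2 * Real.pi * |β| := by
    rw [abs_mul, mul_comm]
    refine mul_le_mul_of_nonneg_right ?_ (abs_nonneg β)
    have h := abs_le.1 (abs_arg_le_pi w)
    have h' := abs_le.1 (abs_arg_le_pi w')
    rw [abs_le]
    constructor <;> linarith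
  linarith [neg_le_of_abs_le h1]

/-- As the center of rotation goes to infinity along the curve that keeps the slope `m` at the base
point, the profile eventually lies above every function with that slope at the base point and with
the given bounds: near the base point by comparing derivatives, elsewhere because the profile
becomes large. -/
lemma exists_forall_lt_profile_sub (hk : 0 < k) (β m : ℝ) {C : ℝ} (hC : 0 ≤ C) :
    ∃ X₀ : ℝ, 1 ≤ X₀ ∧ ∀ X, X₀ ≤ X → ∀ ζ, ζ = slopeLine k β m X → ∀ γ γ' : ℝ → ℝ,
      (∀ s, HasDerivAt γ (γ' s) s) → (∀ s, |s| ≤ Real.pi → |γ' s - m| ≤ C * |s|) →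
      (∀ s, |s| ≤ Real.pi → γ s - γ 0 ≤ C) → ∀ s, s ≠ 0 → |s| ≤ Real.pi →
        γ s - γ 0 < profile k β (ζ / (1 + ζ)) s - profile k β (ζ / (1 + ζ)) 0 := by
  obtain ⟨δ, X₁, hδ0, hδ1, hnear⟩ := exists_slope_comparison (m / (2 * k)) β
    (by positivity : 0 ≤ C / (2 * k))
  have hδπ : δ ≤ Real.pi := by linarith [Real.pi_gt_three]
  have hη : 0 < 1 - Real.cos δ := by
    have := Real.cos_lt_cos_of_nonneg_of_le_pi le_rfl hδπ hδ0
    rw [Real.cos_zero] at this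
    linarith
  obtain ⟨E, hE⟩ : ∃ E, E = Real.exp ((C + 1) / (2 * k) + 2 * Real.pi * |β|) := ⟨_, rfl⟩
  refine ⟨max 1 (max X₁ ((E + 1) / (1 - Real.cos δ))), le_max_left _ _, ?_⟩
  intro X hX ζ hζ γ γ' hγ hγ' hγC s hs0 hs
  have hX0 : 1 ≤ X := (le_max_left _ _).trans hX
  have hX1 : X₁ ≤ X := ((le_max_left _ _).trans (le_max_right _ _)).trans hX
  have hX2 : (E + 1) / (1 - Real.cos δ) ≤ X :=
    ((le_max_right _ _).trans (le_max_right _ _)).trans hX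
  have hre : ζ.re = X := by rw [hζ]; rfl
  have him : ζ.im = m / (2 * k) + β * X := by rw [hζ]; rfl
  have hζ0 : 0 < ζ.re := by linarith
  rcases le_or_gt |s| δ with hsδ | hsδ
  · have hd : ∀ s, HasDerivAt (fun s => profile k β (ζ / (1 + ζ)) s - γ s) _ s := fun s =>
      (hasDerivAt_profile hζ0 (by rw [hre]; exact him) s).sub (hγ s)
    have := lt_of_mul_deriv_pos hd (δ := δ) (fun s hs0 hsδ => ?_) hs0 hsδ
    · linarith
    have hn := hnear X ζ.im _ hX1 him rfl s hs0 hsδ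
    have hN : 0 < normSq (1 + (1 - exp (s * I)) * ζ) := by
      have := slitPlane_ne_zero
        (one_sub_mem_slitPlane (norm_mul_exp_lt (norm_div_one_add_lt hζ0) s))
      rw [one_sub_mul_exp hζ0] at this
      exact normSq_pos.2 (div_ne_zero_iff.1 this).1
    have hNe := normSq_one_add_mul ζ s
    rw [hre] at hNe
    rw [← hNe] at hn
    rw [hre]
    have hb : s * γ' s ≤ m * s + C * s ^ 2 := by
      have h1 := hγ' s (hsδ.trans hδπ)
      have h2 : s * (γ' s - m) ≤ |s| * (C * |s|) := by
        refine (le_abs_self _).trans ?_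
        rw [abs_mul]
        exact mul_le_mul_of_nonneg_left h1 (abs_nonneg s)
      nlinarith [sq_abs s]
    rw [mul_sub, sub_pos]
    refine hb.trans_lt ?_
    rw [mul_div_assoc', lt_div_iff₀ hN]
    have e : (m * s + C * s ^ 2) = 2 * k * (m / (2 * k) * s + C / (2 * k) * s ^ 2) := by
      field_simp
    rw [e]
    have := mul_lt_mul_of_pos_left hn (by positivity : 0 < 2 * k)
    linarith
  · refine (hγC s hs).trans_lt (lt_of_lt_of_le ?_ (le_profile_sub hk hζ0 s))
    have hcos : Real.cos s ≤ Real.cos δ := by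
      rw [← Real.cos_abs s]
      exact Real.cos_le_cos_of_nonneg_of_le_pi hδ0.le hs hsδ.le
    have hNE : E ≤ ‖1 + (1 - exp (s * I)) * ζ‖ := by
      have h1 : 1 - Real.cos δ ≤ ‖1 - exp (s * I)‖ := by
        refine le_trans ?_ (re_le_norm _)
        rw [sub_re, one_re, exp_ofReal_mul_I_re]
        linarith
      have h2 : X ≤ ‖ζ‖ := hre ▸ re_le_norm ζ
      have h3 : (1 - Real.cos δ) * X ≤ ‖(1 - exp (s * I)) * ζ‖ := by
        rw [norm_mul]
        exact mul_le_mul h1 h2 (by linarith) (norm_nonneg _)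
      have h4 := norm_sub_le (1 + (1 - exp (s * I)) * ζ) 1
      rw [add_sub_cancel_left, norm_one] at h4
      rw [div_le_iff₀ hη] at hX2
      linarith
    have hlog := Real.log_le_log (by rw [hE]; positivity) hNE
    rw [hE, Real.log_exp] at hlog
    have h5 : (C + 1) / (2 * k) ≤
        Real.log ‖1 + (1 - exp (s * I)) * ζ‖ - 2 * Real.pi * |β| := by linarith
    rw [div_le_iff₀ (by positivity)] at h5
    linarith

/-- The points `slopeLine k β m X / (1 + slopeLine k β m X)` with `X` large take every modulus close
enough to `1`. -/
lemma exists_norm_slopeLine_div_eq (k β m : ℝ) {X₀ : ℝ} (hX₀ : 1 ≤ X₀) :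
    ∃ r₀ : ℝ, 0 ≤ r₀ ∧ r₀ < 1 ∧ ∀ r, r₀ ≤ r → r < 1 →
      ∃ X, X₀ ≤ X ∧ ‖slopeLine k β m X / (1 + slopeLine k β m X)‖ = r := by
  have hpos : ∀ X, X₀ ≤ X → 0 < (slopeLine k β m X).re := fun X hX => by
    change 0 < X
    linarith
  have hcont : Continuous (slopeLine k β m) := by
    have : slopeLine k β m = fun X : ℝ => ((X : ℂ) + ((m / (2 * k) + β * X : ℝ) : ℂ) * I) := by
      ext X
      exact (re_add_im (slopeLine k β m X)).symm
    rw [this]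
    fun_prop
  have htend : Filter.Tendsto (fun X => ‖slopeLine k β m X / (1 + slopeLine k β m X)‖)
      Filter.atTop (nhds 1) := by
    have hlow : Filter.Tendsto (fun X : ℝ => 1 - X⁻¹) Filter.atTop (nhds 1) := by
      simpa using tendsto_inv_atTop_zero.const_sub (1 : ℝ)
    refine tendsto_of_tendsto_of_tendsto_of_le_of_le' hlow tendsto_const_nhds ?_ ?_
    · filter_upwards [Filter.eventually_ge_atTop X₀] with X hX
      have h0 := one_add_ne_zero_of_re (hpos X hX)
      have e : slopeLine k β m X / (1 + slopeLine k β m X) = 1 - (1 + slopeLine k β m X)⁻¹ := by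
        field_simp
        ring
      have h1 : X ≤ ‖1 + slopeLine k β m X‖ := by
        refine le_trans ?_ (re_le_norm _)
        rw [add_re, one_re]
        change X ≤ 1 + X
        linarith
      have h2 : ‖(1 + slopeLine k β m X)⁻¹‖ ≤ X⁻¹ := by
        rw [norm_inv]
        exact inv_anti₀ (by linarith) h1
      have h3 := norm_sub_norm_le 1 (1 + slopeLine k β m X)⁻¹
      rw [norm_one] at h3
      rw [e]
      linarith
    · filter_upwards [Filter.eventually_ge_atTop X₀] with X hX
      exact (norm_div_one_add_lt (hpos X hX)).le
  have hco : ContinuousOn (fun X => ‖slopeLine k β m X / (1 + slopeLine k β m X)‖) (Ici X₀) :=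
    (hcont.continuousOn.div (continuous_const.add hcont).continuousOn
      fun X hX => one_add_ne_zero_of_re (hpos X hX)).norm
  have hivt := isPreconnected_Ici.intermediate_value_Ico (self_mem_Ici (a := X₀))
    (Filter.le_principal_iff.2 (Filter.Ici_mem_atTop X₀)) hco htend
  refine ⟨_, norm_nonneg _, norm_div_one_add_lt (hpos X₀ le_rfl), fun r h1 h2 => ?_⟩
  obtain ⟨X, hX, e⟩ := hivt ⟨h1, h2⟩
  exact ⟨X, hX, e⟩

end

/-! ### Functions on the circle -/

lemma contDiff_comp_circle_exp {g : Circle → ℝ} (hg : ContMDiff (𝓡 1) 𝓘(ℝ, ℝ) ∞ g) (q : Circle) :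
    ContDiff ℝ ∞ fun s : ℝ => g (q * Circle.exp s) :=
  (hg.comp (contMDiff_const.mul contMDiff_circleExp)).contDiff

lemma deriv_comp_circle_exp_eq_zero {g : Circle → ℝ} (hg : ContMDiff (𝓡 1) 𝓘(ℝ, ℝ) ∞ g) (q : Circle)
    (h : mfderiv (𝓡 1) 𝓘(ℝ, ℝ) g q = 0) : deriv (fun s : ℝ => g (q * Circle.exp s)) 0 = 0 := by
  have hc : ContMDiff 𝓘(ℝ, ℝ) (𝓡 1) ∞ fun s : ℝ => q * Circle.exp s :=
    contMDiff_const.mul contMDiff_circleExp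
  have hq : q * Circle.exp 0 = q := by simp
  have h1 := mfderiv_comp (0 : ℝ) ((hg (q * Circle.exp 0)).mdifferentiableAt (by simp))
    ((hc 0).mdifferentiableAt (by simp))
  rw [hq, h, mfderiv_eq_fderiv] at h1
  have h2 : fderiv ℝ (g ∘ fun s : ℝ => q * Circle.exp s) 0 = 0 := by
    rw [h1]
    rfl
  rw [← fderiv_apply_one_eq_deriv]
  exact congrArg (fun L : ℝ →L[ℝ] ℝ => L 1) h2

lemma exists_bounds {γ : ℝ → ℝ} (hγ : ContDiff ℝ ∞ γ) : ∃ C : ℝ, 0 ≤ C ∧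
    (∀ s, |s| ≤ Real.pi → |deriv γ s - deriv γ 0| ≤ C * |s|) ∧
    ∀ s, |s| ≤ Real.pi → γ s - γ 0 ≤ C := by
  have h1 : ContDiff ℝ ∞ (deriv γ) := (contDiff_infty_iff_deriv.1 hγ).2
  have h2 : ContDiff ℝ ∞ (deriv (deriv γ)) := (contDiff_infty_iff_deriv.1 h1).2
  obtain ⟨C₁, hC₁⟩ := (isCompact_Icc (a := -Real.pi) (b := Real.pi)).exists_bound_of_continuousOn
    h2.continuous.continuousOn
  obtain ⟨C₂, hC₂⟩ := (isCompact_Icc (a := -Real.pi) (b := Real.pi)).exists_bound_of_continuousOn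
    (hγ.continuous.sub continuous_const : Continuous fun s => γ s - γ 0).continuousOn
  have h0 : (0 : ℝ) ∈ Icc (-Real.pi) Real.pi := abs_le.1 (by simpa using Real.pi_pos.le)
  refine ⟨max C₁ C₂, ((norm_nonneg _).trans (hC₁ 0 h0)).trans (le_max_left _ _),
    fun s hs => ?_, fun s hs => ?_⟩
  · have := (convex_Icc (-Real.pi) Real.pi).norm_image_sub_le_of_norm_deriv_le
      (fun x _ => h1.differentiable (by simp) x) hC₁ h0 (abs_le.1 hs)
    rw [Real.norm_eq_abs, Real.norm_eq_abs, sub_zero] at this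
    exact this.trans (mul_le_mul_of_nonneg_right (le_max_left _ _) (abs_nonneg s))
  · exact ((le_abs_self _).trans (hC₂ s (abs_le.1 hs))).trans (le_max_right _ _)

lemma contMDiff_tiltedSlice_circle (hH₀ : 0 < H) (hH₁ : H < 1 / 2) {a : ℂ} (ha : ‖a‖ < 1) (t : ℝ) :
    ContMDiff (𝓡 1) 𝓘(ℝ, ℝ) ∞ fun p : Circle => tiltedSlice τ H a t p := by
  have : Fact (Module.finrank ℝ ℂ = 1 + 1) := ⟨Complex.finrank_real_complex⟩
  have hcoe : ContMDiff (𝓡 1) 𝓘(ℝ, ℂ) ∞ fun p : Circle => (p : ℂ) := contMDiff_coe_sphere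
  intro p
  exact (contDiffAt_tiltedSlice hH₀ hH₁ ha t (Circle.norm_coe p).le).contMDiffAt.comp p (hcoe p)

/-- On the circle the two terms with `regHeight` cancel. -/
lemma tiltedSlice_circle (hH₀ : 0 < H) (hH₁ : H < 1 / 2) {a : ℂ} (ha : ‖a‖ < 1) (t : ℝ)
    {q : Circle} {b : ℂ} (hb : conj a * q = b) (s : ℝ) :
    tiltedSlice τ H a t (q * Circle.exp s : Circle) =
      profile (growthRate τ H) (-2 * τ / growthRate τ H) b s + t := by
  have hK : (growthRate τ H : ℂ) ≠ 0 := by exact_mod_cast (growthRate_pos hH₀ hH₁).ne'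
  obtain ⟨p, hp⟩ : ∃ p, p = q * Circle.exp s := ⟨_, rfl⟩
  have hmob : normSq (mob a p) = 1 := by
    have := one_sub_normSq_mob ha (Circle.norm_coe p).le
    rw [Circle.normSq_coe, sub_self, mul_zero, zero_div] at this
    linarith
  have e : conj a * p = b * exp (s * I) := by
    rw [hp, Circle.coe_mul, Circle.coe_exp, ← mul_assoc, hb]
  rw [← hp, tiltedSlice, hmob, Circle.normSq_coe, sub_self, add_zero, e, profile]
  congr 3
  push_cast
  field_simp
  ring

end HCylinder

end

theorem proposition5p2 (τ H : ℝ) (hH₀ : 0 < H) (hH₁ : H < 1 / 2)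
    (g : Circle → ℝ) (hg : ContMDiff (𝓡 1) 𝓘(ℝ, ℝ) ∞ g) (q : Circle) :
    ∃ c₀ : ℝ, 0 < c₀ ∧ ∀ c : ℝ, c₀ ≤ c →
      ∃ (a : ℂ) (u : ℂ → ℝ) (f : Circle → ℝ),
        ‖a‖ = Real.tanh (c / 2) ∧
        HCylinder.IsEntireHGraph τ H u ∧
        HCylinder.IsRotationallyInvariant τ H a (HCylinder.graph u) ∧
        ContMDiff (𝓡 1) 𝓘(ℝ, ℝ) ∞ f ∧
        HCylinder.HasAsymptoticBoundaryValue u f ∧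
        f q = g q ∧
        (∀ p : Circle, p ≠ q → g p < f p) ∧
        (mfderiv (𝓡 1) 𝓘(ℝ, ℝ) g q = 0 → ∀ p : Circle, f q ≤ f p) := by
  open HCylinder ComplexConjugate in
  obtain ⟨γ, hγdef⟩ : ∃ γ : ℝ → ℝ, γ = fun s => g (q * Circle.exp s) := ⟨_, rfl⟩
  have hγ : ContDiff ℝ ∞ γ := hγdef ▸ contDiff_comp_circle_exp hg q
  obtain ⟨C, hC, hC₁, hC₂⟩ := exists_bounds hγ
  have hK := growthRate_pos (τ := τ) hH₀ hH₁
  obtain ⟨K, hKdef⟩ : ∃ K, K = growthRate τ H := ⟨_, rfl⟩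
  rw [← hKdef] at hK
  obtain ⟨X₀, hX₀, hmain⟩ := exists_forall_lt_profile_sub hK (-2 * τ / K) (deriv γ 0) hC
  obtain ⟨r₀, hr₀, hr₁, hex⟩ := exists_norm_slopeLine_div_eq K (-2 * τ / K) (deriv γ 0) hX₀
  have hr₀' : r₀ ∈ Set.Ioo (-1 : ℝ) 1 := ⟨by linarith, hr₁⟩
  refine ⟨max 1 (2 * Real.artanh r₀), lt_of_lt_of_le one_pos (le_max_left _ _), fun c hc => ?_⟩
  have hc' : Real.artanh r₀ ≤ c / 2 := by linarith [(le_max_right _ _).trans hc]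
  have hr : r₀ ≤ Real.tanh (c / 2) := by
    rwa [← Real.artanh_le_artanh_iff hr₀' ⟨Real.neg_one_lt_tanh _, Real.tanh_lt_one _⟩,
      Real.artanh_tanh]
  obtain ⟨X, hX, hnorm⟩ := hex _ hr (Real.tanh_lt_one _)
  obtain ⟨ζ, hζ⟩ : ∃ ζ, ζ = slopeLine K (-2 * τ / K) (deriv γ 0) X := ⟨_, rfl⟩
  rw [← hζ] at hnorm
  obtain ⟨b, hb⟩ : ∃ b, b = ζ / (1 + ζ) := ⟨_, rfl⟩
  have hlt := hmain X hX ζ hζ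
  rw [← hb] at hnorm hlt
  -- The center is placed so that `ā q = b`.
  obtain ⟨a, ha⟩ : ∃ a, a = conj b * (q : ℂ) := ⟨_, rfl⟩
  have hab : conj a * q = b := by
    rw [ha, map_mul, Complex.conj_conj, mul_assoc, mul_comm (conj (q : ℂ)), Complex.mul_conj]
    simp
  have hna : ‖a‖ = Real.tanh (c / 2) := by
    rw [ha, norm_mul, Complex.norm_conj, Circle.norm_coe, mul_one, hnorm]
  have ha1 : ‖a‖ < 1 := hna ▸ Real.tanh_lt_one _
  obtain ⟨t, ht⟩ : ∃ t, t = g q - profile K (-2 * τ / K) b 0 := ⟨_, rfl⟩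
  have hval : ∀ s : ℝ, tiltedSlice τ H a t (q * Circle.exp s : Circle) =
      g q + (profile K (-2 * τ / K) b s - profile K (-2 * τ / K) b 0) := fun s => by
    rw [tiltedSlice_circle hH₀ hH₁ ha1 t hab, ← hKdef, ht]
    ring
  have hfq : tiltedSlice τ H a t (q : ℂ) = g q := by
    have := hval 0
    rwa [Circle.exp_zero, mul_one, sub_self, add_zero] at this
  have hγ0 : γ 0 = g q := by simp [hγdef]
  have hpar : ∀ p : Circle, p ≠ q → ∃ s : ℝ, s ≠ 0 ∧ |s| ≤ Real.pi ∧ p = q * Circle.exp s :=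
    fun p hp => by
      have e : p = q * Circle.exp (Complex.arg (q⁻¹ * p : Circle)) := by
        rw [Circle.exp_arg, mul_inv_cancel_left]
      refine ⟨_, fun h => hp ?_, Complex.abs_arg_le_pi _, e⟩
      rw [h, Circle.exp_zero, mul_one] at e
      exact e
  refine ⟨a, tiltedSlice τ H a t, fun p => tiltedSlice τ H a t p, hna,
    isEntireHGraph_tiltedSlice hH₀ hH₁ (mem_disk.2 ha1) t,
    isRotationallyInvariant_tiltedSlice hH₀ hH₁ (mem_disk.2 ha1) t,
    contMDiff_tiltedSlice_circle hH₀ hH₁ ha1 t, fun p => ?_, hfq, fun p hp => ?_,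
    fun hcrit p => ?_⟩
  · exact (contDiffAt_tiltedSlice hH₀ hH₁ ha1 t
      (Circle.norm_coe p).le).continuousAt.tendsto.mono_left nhdsWithin_le_nhds
  · obtain ⟨s, hs0, hs, rfl⟩ := hpar p hp
    have h := hlt γ (deriv γ) (fun s => (hγ.differentiable (by simp) s).hasDerivAt) hC₁ hC₂ s hs0 hs
    have hγs : γ s = g (q * Circle.exp s) := by rw [hγdef]
    change g (q * Circle.exp s) < tiltedSlice τ H a t (q * Circle.exp s : Circle)
    rw [hval]
    linarith
  · by_cases hp : p = q
    · rw [hp]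
    obtain ⟨s, hs0, hs, rfl⟩ := hpar p hp
    -- At a critical point the slope is `0`, so the comparison also applies to constants.
    have hm : deriv γ 0 = 0 := by
      rw [hγdef]
      exact deriv_comp_circle_exp_eq_zero hg q hcrit
    have h := hlt (fun _ => 0) (fun _ => 0) (fun s => hasDerivAt_const s 0)
      (fun s _ => by rw [hm]; simpa using mul_nonneg hC (abs_nonneg s))
      (fun s _ => by simpa using hC) s hs0 hs
    change tiltedSlice τ H a t q ≤ tiltedSlice τ H a t (q * Circle.exp s : Circle)
    rw [hfq, hval]
    linarith
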